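/- **Theorem.** Let $U$ be a unitary on $\mathbb C^{d_A}\otimes\mathbb C^{d_B}$ of Schmidt rank $3$, i.e. $U=\sum_{j=1}^3 S_j\otimes R_j$ with $S_1,S_2,S_3$ linearly independent and $R_1,R_2,R_3$ linearly independent. Assume that $U$ is controlled from the $A$ side: $U=(P\otimes Q)\,C\,(R\otimes S)$ with unitaries $P,R$ on $\mathbb C^{d_A}$ and $Q,S$ on $\mathbb C^{d_B}$ (we then say that $U$ and $C$ are locally equivalent), where $C=\sum_{j=1}^{d_A}|j\rangle\langle j|\otimes T_j$ for operators $T_j$ on $\mathbb C^{d_B}$ (necessarily unitary). Then the following hold. (i) Either $C$ is the $A$-direct sum of at most three unitaries of Schmidt rank at most $2$ (that is, there is an orthogonal decomposition of $\mathbb C^{d_A}$ into at most three subspaces $H_k$ such that $C$ is the direct sum of unitaries on the $H_k\otimes\mathbb C^{d_B}$, each of Schmidt rank at most $2$), or $U$ is locally equivalent to a $B$-direct sum of controlled unitaries of Schmidt rank at most $3$, each of which acts on $\mathbb C^{d_A}\otimes K$ with $\dim K\in\{1,2\}$ (the subspaces $K\subseteq\mathbb C^{d_B}$ being pairwise orthogonal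 with sum $\mathbb C^{d_B}$) and is controlled in the computational basis of $\mathbb C^{d_A}$, i.e. has the form $\sum_j|j\rangle\langle j|\otimes X_j$ with unitaries $X_j$ on $K$. (ii) There is a single one-shot, exact and deterministic protocol of local operations and classical communication (LOCC) with finitely many rounds that implements $U$, consuming a maximally entangled state with at most $$\log_2\min\{d_A,\ d_B^2,\ 4\lfloor d_B/2\rfloor+2\}$$ ebits (a maximally entangled state of Schmidt rank $N$ counts as $\log_2N$ ebits), and using in both directions together at most $$2\log_2\min\{d_A,\ d_B^2,\ \max\{12,\ 4\lfloor d_B/2\rfloor+2\}\}$$ c-bits (a message that is one of $N$ possible signals counts as $\log_2N$ c-bits). -/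

import Mathlib

open Matrix
open scoped Kronecker BigOperators

/-- `U` has Schmidt rank `r`: it is a sum of `r` product operators, the factors on either side
being linearly independent. -/
def HasSchmidtRank {dA dB : ℕ} (U : Matrix (Fin dA × Fin dB) (Fin dA × Fin dB) ℂ) (r : ℕ) : Prop :=
  ∃ (S : Fin r → Matrix (Fin dA) (Fin dA) ℂ) (T : Fin r → Matrix (Fin dB) (Fin dB) ℂ),
    LinearIndependent ℂ S ∧ LinearIndependent ℂ T ∧ U = ∑ j, S j ⊗ₖ T j

/-- The Schmidt rank of `U` is at most `r`. -/
def SchmidtRankLE {dA dB : ℕ} (U : Matrix (Fin dA × Fin dB) (Fin dA × Fin dB) ℂ) (r : ℕ) : Prop :=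
  ∃ s, s ≤ r ∧ HasSchmidtRank U s

/-- `U` is obtained from `V` by multiplication with local unitaries before and after `V`. -/
def LocallyEquivalent {dA dB : ℕ} (U V : Matrix (Fin dA × Fin dB) (Fin dA × Fin dB) ℂ) : Prop :=
  ∃ (P R : Matrix (Fin dA) (Fin dA) ℂ) (Q S : Matrix (Fin dB) (Fin dB) ℂ),
    P ∈ unitaryGroup (Fin dA) ℂ ∧ R ∈ unitaryGroup (Fin dA) ℂ ∧
    Q ∈ unitaryGroup (Fin dB) ℂ ∧ S ∈ unitaryGroup (Fin dB) ℂ ∧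
    U = (P ⊗ₖ Q) * V * (R ⊗ₖ S)

/-- `W = ∑ j, |j⟩⟨j| ⊗ T j`: the operator `W` is controlled from the `A` side in the computational
basis. If `W` is unitary then so is every `T j`; if `W` is unitary on `ℂ^dA ⊗ H` for a subspace
`H` of `ℂ^dB` and zero on its complement, then every `T j` is unitary on `H`. -/
def IsControlledInBasisA {dA dB : ℕ} (W : Matrix (Fin dA × Fin dB) (Fin dA × Fin dB) ℂ) : Prop :=
  ∃ T : Fin dA → Matrix (Fin dB) (Fin dB) ℂ, W = ∑ j, Matrix.single j j (1 : ℂ) ⊗ₖ T j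

/-- A family of mutually orthogonal orthogonal projections with sum the identity, that is, an
orthogonal decomposition of `ℂ^d` into the ranges of the `E k`. -/
structure IsOrthogonalDecomposition {d n : ℕ} (E : Fin n → Matrix (Fin d) (Fin d) ℂ) : Prop where
  hermitian : ∀ k, (E k).IsHermitian
  mul_eq : ∀ k l, E k * E l = if k = l then E k else 0
  sum_eq : ∑ k, E k = 1

/-- `V` is the `A`-direct sum of the unitaries `W k`, acting on `range (E k) ⊗ ℂ^dB`; each `W k` is
written as an operator on the whole space that vanishes on the orthogonal complement. -/
structure IsADirectSum {dA dB n : ℕ} (V : Matrix (Fin dA × Fin dB) (Fin dA × Fin dB) ℂ)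
    (E : Fin n → Matrix (Fin dA) (Fin dA) ℂ)
    (W : Fin n → Matrix (Fin dA × Fin dB) (Fin dA × Fin dB) ℂ) : Prop where
  decomposition : IsOrthogonalDecomposition E
  unitary_left : ∀ k, (W k)ᴴ * W k = E k ⊗ₖ (1 : Matrix (Fin dB) (Fin dB) ℂ)
  unitary_right : ∀ k, W k * (W k)ᴴ = E k ⊗ₖ (1 : Matrix (Fin dB) (Fin dB) ℂ)
  eq_sum : V = ∑ k, W k

/-- `V` is the `B`-direct sum of the unitaries `W k`, acting on `ℂ^dA ⊗ range (F k)`; each `W k` is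
written as an operator on the whole space that vanishes on the orthogonal complement. -/
structure IsBDirectSum {dA dB n : ℕ} (V : Matrix (Fin dA × Fin dB) (Fin dA × Fin dB) ℂ)
    (F : Fin n → Matrix (Fin dB) (Fin dB) ℂ)
    (W : Fin n → Matrix (Fin dA × Fin dB) (Fin dA × Fin dB) ℂ) : Prop where
  decomposition : IsOrthogonalDecomposition F
  unitary_left : ∀ k, (W k)ᴴ * W k = (1 : Matrix (Fin dA) (Fin dA) ℂ) ⊗ₖ F k
  unitary_right : ∀ k, W k * (W k)ᴴ = (1 : Matrix (Fin dA) (Fin dA) ℂ) ⊗ₖ F k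
  eq_sum : V = ∑ k, W k

/-- LOCC protocols with finitely many rounds, from a bipartite system with local state spaces
`ℂ^X` (Alice) and `ℂ^Y` (Bob) to one with local state spaces `ℂ^A` and `ℂ^B`. In a round one party
applies a quantum instrument to its own system, given by Kraus operators `K m i`; the outcome `m`
is sent to the other party, the outcome `i` is forgotten. The rest of the protocol may depend on
all messages sent so far. The local space may change in each round, so adding ancillas, discarding
systems, and keeping a private record of an outcome in a local register are covered. -/
inductive LOCCProtocol (A B : Type) [Fintype A] [DecidableEq A] [Fintype B] [DecidableEq B] :
    (X Y : Type) → [Fintype X] → [DecidableEq X] → [Fintype Y] → [DecidableEq Y] → Type 1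
  /-- the end of the protocol -/
  | done : LOCCProtocol A B A B
  /-- an instrument of Alice, and a message from Alice to Bob -/
  | alice {X Y : Type} [Fintype X] [DecidableEq X] [Fintype Y] [DecidableEq Y]
      (X' : Type) [Fintype X'] [DecidableEq X'] (M I : Type) [Fintype M] [Fintype I]
      (K : M → I → Matrix X' X ℂ) (hK : ∑ m, ∑ i, (K m i)ᴴ * K m i = 1)
      (next : M → LOCCProtocol A B X' Y) : LOCCProtocol A B X Y
  /-- an instrument of Bob, and a message from Bob to Alice -/
  | bob {X Y : Type} [Fintype X] [DecidableEq X] [Fintype Y] [DecidableEq Y]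
      (Y' : Type) [Fintype Y'] [DecidableEq Y'] (M I : Type) [Fintype M] [Fintype I]
      (K : M → I → Matrix Y' Y ℂ) (hK : ∑ m, ∑ i, (K m i)ᴴ * K m i = 1)
      (next : M → LOCCProtocol A B X Y') : LOCCProtocol A B X Y

/-- The quantum channel that a protocol implements: the output, summed over all outcomes. -/
noncomputable def LOCCProtocol.channel {A B : Type} [Fintype A] [DecidableEq A] [Fintype B]
    [DecidableEq B] {X Y : Type} [Fintype X] [DecidableEq X] [Fintype Y] [DecidableEq Y] :
    LOCCProtocol A B X Y → Matrix (X × Y) (X × Y) ℂ → Matrix (A × B) (A × B) ℂ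
  | .done, ρ => ρ
  | @LOCCProtocol.alice _ _ _ _ _ _ _ Y _ _ _ _ _ _ _ _ _ _ _ K _ next, ρ =>
      ∑ m, (next m).channel
        (∑ i, (K m i ⊗ₖ (1 : Matrix Y Y ℂ)) * ρ * (K m i ⊗ₖ (1 : Matrix Y Y ℂ))ᴴ)
  | @LOCCProtocol.bob _ _ _ _ _ _ X _ _ _ _ _ _ _ _ _ _ _ _ K _ next, ρ =>
      ∑ m, (next m).channel
        (∑ i, ((1 : Matrix X X ℂ) ⊗ₖ K m i) * ρ * ((1 : Matrix X X ℂ) ⊗ₖ K m i)ᴴ)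

/-- The classical communication of a protocol in c-bits, in both directions together: a message
that is one of `N` possible signals counts `log₂ N`, and the maximum over all runs is taken. -/
noncomputable def LOCCProtocol.cbits {A B : Type} [Fintype A] [DecidableEq A] [Fintype B]
    [DecidableEq B] {X Y : Type} [Fintype X] [DecidableEq X] [Fintype Y] [DecidableEq Y] :
    LOCCProtocol A B X Y → ℝ
  | .done => 0
  | @LOCCProtocol.alice _ _ _ _ _ _ _ _ _ _ _ _ _ _ _ M _ _ _ _ _ next =>
      Real.logb 2 (Fintype.card M) + ⨆ m, (next m).cbits
  | @LOCCProtocol.bob _ _ _ _ _ _ _ _ _ _ _ _ _ _ _ M _ _ _ _ _ next =>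
      Real.logb 2 (Fintype.card M) + ⨆ m, (next m).cbits

/-- The maximally entangled state `N^(-1/2) ∑ k, |k⟩|k⟩` of Schmidt rank `N`. -/
noncomputable def maxEntangledState (N : ℕ) : Fin N × Fin N → ℂ :=
  fun k => if k.1 = k.2 then ((1 / Real.sqrt N : ℝ) : ℂ) else 0

/-- The input `ρ` together with the resource state of Schmidt rank `N`, each party holding its
part of both. -/
noncomputable def withResource {A B : Type} (N : ℕ) (ρ : Matrix (A × B) (A × B) ℂ) :
    Matrix ((A × Fin N) × (B × Fin N)) ((A × Fin N) × (B × Fin N)) ℂ :=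
  Matrix.of fun x y => ρ (x.1.1, x.2.1) (y.1.1, y.2.1) *
    (maxEntangledState N (x.1.2, x.2.2) * star (maxEntangledState N (y.1.2, y.2.2)))

/-- `U` can be implemented exactly and with certainty by a (one-shot) LOCC protocol that consumes a
maximally entangled state with at most `e` ebits, where Schmidt rank `N` counts `log₂ N` ebits, and
at most `c` c-bits. -/
def ImplementableByLOCC {dA dB : ℕ} (U : Matrix (Fin dA × Fin dB) (Fin dA × Fin dB) ℂ)
    (e c : ℝ) : Prop :=
  ∃ (N : ℕ) (p : LOCCProtocol (Fin dA) (Fin dB) (Fin dA × Fin N) (Fin dB × Fin N)),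
    0 < N ∧ Real.logb 2 N ≤ e ∧ p.cbits ≤ c ∧
    ∀ ρ : Matrix (Fin dA × Fin dB) (Fin dA × Fin dB) ℂ,
      p.channel (withResource N ρ) = U * ρ * Uᴴ

/-!
Write the controlled unitary as `∑ j, |j⟩⟨j| ⊗ T j`. Since the Schmidt rank is three, all the
unitaries `T j` are combinations of three of them, `X 0`, `X 1` and `X 2`.

*Structure.* If every `T j` has such an expansion with a vanishing coefficient, then sorting the
terms by a vanishing coefficient gives the `A`-direct sum of at most three unitaries of Schmidt rank
at most two. Otherwise there is a unitary `a X 0 + b X 1 + c X 2` with `a b c ≠ 0`. After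
multiplication with `(X 0)ᴴ` it reads `α + x + y = w` with multiples `x`, `y`, `w` of unitaries and
`α ≠ 0`. The element `α + x` is normal, so `w - y` is normal as well, and this forces `x + xᴴ` to
commute with `y` (`commute_add_of_add_add_eq`). Hence `x + xᴴ` and `y + yᴴ` are central in the
algebra generated by `x` and `y`, and for a common eigenvector `v` of these and of `x` the span of
`v` and `y v` is invariant (`exists_invariant_finrank_le_two`). Splitting off such subspaces, one
obtains an orthonormal basis with an involution `σ` of its index set, such that all the `(X 0)ᴴ T j`
only connect a basis vector `i` with `i` and `σ i` (`exists_unitary_paired`). The pairs are the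
blocks of the `B`-direct sum.

*Protocols.* They are all instances of one protocol (`implementableByLOCC_of_blocks`): Alice shares
a block label `κ j ∈ K` coherently with Bob; Bob entangles a label `h ∈ H` with his system by
unitaries `R κ h`; Alice applies unitary matrices `M` on the labels `h` with
`∑ h, M g h j • R (κ j) h = Q (κ j) g * T j`, which has the effect of `T j` on Bob's system; both
labels are removed by measurements in conjugate bases. The cost is a resource of Schmidt rank
`N = |K| |H|` and `2 log₂ N` c-bits. It is used in three ways.

* `N = dA`: the block is the whole control register and `H` is trivial.
* `N = 2 dB`, when the `T j` are block diagonal for a pairing `σ`: the unitaries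
  `|i⟩ ↦ χ k i |σ ^ a i⟩` with `a ∈ Bool` serve as `R` (`implementableByLOCC_paired`). For `dB = 2`
  this always applies, and `N = dB ^ 2`.
* `N = 6`, when each `T j` has a vanishing coefficient: if a proper combination of `X i` and `X k` is
  unitary, then `(X i)ᴴ X k` has at most two eigenvalues, so all unitary combinations of `X i` and
  `X k` have the form `X i (x F + y (1 - F))` with one projection `F`, and `|H| = 2` suffices for
  such a block. Three blocks of this kind cover all the `T j` (`exists_three_covering_blocks`).

The smallest of these numbers that applies is at most `min dA (min (dB ^ 2) (4 * (dB / 2) + 2))`.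
-/

/-! ### Schmidt rank -/

/-- A shortest expansion of `U` into product operators has linearly independent factors. -/
theorem schmidtRankLE_of_eq_sum {dA dB r : ℕ}
    {U : Matrix (Fin dA × Fin dB) (Fin dA × Fin dB) ℂ}
    (S : Fin r → Matrix (Fin dA) (Fin dA) ℂ) (T : Fin r → Matrix (Fin dB) (Fin dB) ℂ)
    (h : U = ∑ j, S j ⊗ₖ T j) : SchmidtRankLE U r := by
  induction r with
  | zero => exact ⟨0, le_rfl, S, T, linearIndependent_empty_type, linearIndependent_empty_type, h⟩
  | succ r ih =>
    by_cases hS : LinearIndependent ℂ S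
    · by_cases hT : LinearIndependent ℂ T
      · exact ⟨r + 1, le_rfl, S, T, hS, hT, h⟩
      · rw [linearIndependent_iff_notMem_span] at hT
        push Not at hT
        obtain ⟨i, hi⟩ := hT
        have him : T '' (Set.univ \ {i}) = Set.range fun k => T (i.succAbove k) := by
          rw [← Set.compl_eq_univ_sdiff, ← Fin.range_succAbove, ← Set.range_comp]; rfl
        rw [him, Submodule.mem_span_range_iff_exists_fun] at hi
        obtain ⟨c, hc⟩ := hi
        obtain ⟨s, hs, hs'⟩ := ih (fun k => S (i.succAbove k) + c k • S i)
          (fun k => T (i.succAbove k)) (by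
            rw [h, Fin.sum_univ_succAbove _ i, ← hc]
            simp only [add_kronecker, Finset.sum_add_distrib, smul_kronecker]
            rw [add_comm]
            congr 1
            ext ⟨x, y⟩ ⟨x', y'⟩
            simp only [kroneckerMap_apply, Matrix.sum_apply, Matrix.smul_apply, smul_eq_mul,
              Finset.mul_sum]
            exact Finset.sum_congr rfl fun k _ => by ring)
        exact ⟨s, hs.trans (Nat.le_succ r), hs'⟩
    · rw [linearIndependent_iff_notMem_span] at hS
      push Not at hS
      obtain ⟨i, hi⟩ := hS
      have him : S '' (Set.univ \ {i}) = Set.range fun k => S (i.succAbove k) := by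
        rw [← Set.compl_eq_univ_sdiff, ← Fin.range_succAbove, ← Set.range_comp]; rfl
      rw [him, Submodule.mem_span_range_iff_exists_fun] at hi
      obtain ⟨c, hc⟩ := hi
      obtain ⟨s, hs, hs'⟩ := ih (fun k => S (i.succAbove k))
        (fun k => T (i.succAbove k) + c k • T i) (by
          rw [h, Fin.sum_univ_succAbove _ i, ← hc]
          simp only [kronecker_add, Finset.sum_add_distrib, kronecker_smul]
          rw [add_comm]
          congr 1
          ext ⟨x, y⟩ ⟨x', y'⟩
          simp only [kroneckerMap_apply, Matrix.sum_apply, Matrix.smul_apply, smul_eq_mul,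
            Finset.sum_mul]
          exact Finset.sum_congr rfl fun k _ => by ring)
      exact ⟨s, hs.trans (Nat.le_succ r), hs'⟩

/-! ### Two unitaries with a unitary linear combination -/

open scoped ComplexOrder in
/-- A Hermitian matrix whose square is a scalar is a combination of a projection and its
complement. -/
theorem exists_projection_of_sq_eq_smul {B : Type} [Fintype B] [DecidableEq B]
    {K : Matrix B B ℂ} (hK : Kᴴ = K) {k : ℝ} (hKK : K * K = (k : ℂ) • (1 : Matrix B B ℂ)) :
    ∃ (F : Matrix B B ℂ) (s : ℂ), Fᴴ = F ∧ F * F = F ∧ K = s • F - s • (1 - F) := by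
  by_cases hk : 0 < k
  · have hs : ((Real.sqrt k : ℝ) : ℂ) ≠ 0 := by
      exact_mod_cast (Real.sqrt_pos.2 hk).ne'
    have hss : ((Real.sqrt k : ℝ) : ℂ) * ((Real.sqrt k : ℝ) : ℂ) = k := by
      rw [← Complex.ofReal_mul, Real.mul_self_sqrt hk.le]
    refine ⟨(1 / 2 : ℂ) • (1 + ((Real.sqrt k : ℝ) : ℂ)⁻¹ • K), (Real.sqrt k : ℝ), ?_, ?_, ?_⟩
    · rw [conjTranspose_smul, conjTranspose_add, conjTranspose_smul, hK, conjTranspose_one]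
      simp
    · have hsk : ((Real.sqrt k : ℝ) : ℂ)⁻¹ * (((Real.sqrt k : ℝ) : ℂ)⁻¹ * (k : ℂ)) = 1 := by
        rw [← hss]; field_simp
      rw [Matrix.smul_mul, Matrix.mul_smul]
      have hsq : (((Real.sqrt k : ℝ) : ℂ)⁻¹ • K) * (((Real.sqrt k : ℝ) : ℂ)⁻¹ • K) = 1 := by
        rw [Matrix.smul_mul, Matrix.mul_smul, hKK, smul_smul, smul_smul, mul_assoc, hsk, one_smul]
      simp only [Matrix.add_mul, Matrix.mul_add, Matrix.one_mul, Matrix.mul_one, hsq]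
      module
    · have : K = (((Real.sqrt k : ℝ) : ℂ) * ((Real.sqrt k : ℝ) : ℂ)⁻¹) • K := by
        rw [mul_inv_cancel₀ hs, one_smul]
      conv_lhs => rw [this]
      module
  · have h0 : K = 0 := by
      rw [← Matrix.conjTranspose_mul_self_eq_zero, hK, hKK]
      cases isEmpty_or_nonempty B with
      | inl h => exact Subsingleton.elim _ _
      | inr h =>
        obtain ⟨i⟩ := h
        have h1 : (Kᴴ * K) i i = (k : ℂ) := by rw [hK, hKK]; simp
        have h2 : (0 : ℝ) ≤ k := by
          have h3 : ((∑ x, Complex.normSq (K x i) : ℝ) : ℂ) = k := by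
            rw [← h1, mul_apply]
            push_cast
            refine Finset.sum_congr rfl fun x _ => ?_
            rw [conjTranspose_apply, Complex.normSq_eq_conj_mul_self]; rfl
          rw [← Complex.ofReal_injective h3]
          exact Finset.sum_nonneg fun x _ => Complex.normSq_nonneg _
        rw [le_antisymm (not_lt.1 hk) h2]
        simp
    exact ⟨1, 0, by simp, by simp, by simp [h0]⟩

/-- If a proper linear combination of the unitaries `X` and `Y` is unitary, then `Xᴴ Y` has at most
two eigenvalues: its Hermitian part, after multiplication by a suitable number, is a scalar. -/
theorem exists_projection_of_smul_add_smul_mem_unitaryGroup {B : Type} [Fintype B] [DecidableEq B]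
    {X Y : Matrix B B ℂ} (hX : X ∈ unitaryGroup B ℂ) (hY : Y ∈ unitaryGroup B ℂ) {a b : ℂ}
    (ha : a ≠ 0) (hb : b ≠ 0) (hab : a • X + b • Y ∈ unitaryGroup B ℂ) :
    ∃ (F : Matrix B B ℂ) (x y : ℂ), Fᴴ = F ∧ F * F = F ∧ Y = X * (x • F + y • (1 - F)) := by
  have hX1 : Xᴴ * X = 1 := mem_unitaryGroup_iff'.1 hX
  have hX2 : X * Xᴴ = 1 := mem_unitaryGroup_iff.1 hX
  have hY1 : Yᴴ * Y = 1 := mem_unitaryGroup_iff'.1 hY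
  have hab1 : (a • X + b • Y)ᴴ * (a • X + b • Y) = 1 := mem_unitaryGroup_iff'.1 hab
  set p : ℂ := star a * b with hp
  have hp0 : p ≠ 0 := mul_ne_zero (star_ne_zero.2 ha) hb
  set r : ℝ := 1 - Complex.normSq a - Complex.normSq b with hr
  have hrel : p • (Xᴴ * Y) + star p • (Yᴴ * X) = (r : ℂ) • (1 : Matrix B B ℂ) := by
    simp only [conjTranspose_add, conjTranspose_smul, Matrix.add_mul, Matrix.mul_add,
      Matrix.smul_mul, Matrix.mul_smul, hX1, hY1] at hab1
    have hna : (Complex.normSq a : ℂ) = star a * a := Complex.normSq_eq_conj_mul_self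
    have hnb : (Complex.normSq b : ℂ) = star b * b := Complex.normSq_eq_conj_mul_self
    have hrr : (r : ℂ) • (1 : Matrix B B ℂ) = 1 - (star a * a) • 1 - (star b * b) • 1 := by
      rw [hr]; push_cast; rw [hna, hnb, sub_smul, sub_smul, one_smul]
    rw [hrr, ← sub_eq_zero, hp, star_mul', star_star]
    rw [← sub_eq_zero] at hab1
    rw [← hab1]
    module
  have hK : ((-Complex.I) • (p • (Xᴴ * Y) - ((r : ℂ) / 2) • (1 : Matrix B B ℂ)))ᴴ =
      (-Complex.I) • (p • (Xᴴ * Y) - ((r : ℂ) / 2) • (1 : Matrix B B ℂ)) := by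
    have h1 : star p • (Yᴴ * X) = (r : ℂ) • (1 : Matrix B B ℂ) - p • (Xᴴ * Y) :=
      eq_sub_of_add_eq' hrel
    have h2 : star ((r : ℂ) / 2) = (r : ℂ) / 2 := by simp
    rw [conjTranspose_smul, conjTranspose_sub, conjTranspose_smul, conjTranspose_smul,
      conjTranspose_mul, conjTranspose_conjTranspose, conjTranspose_one, h1, h2]
    simp only [star_neg, RCLike.star_def, Complex.conj_I]
    module
  have hKK : ((-Complex.I) • (p • (Xᴴ * Y) - ((r : ℂ) / 2) • (1 : Matrix B B ℂ))) *
      ((-Complex.I) • (p • (Xᴴ * Y) - ((r : ℂ) / 2) • (1 : Matrix B B ℂ))) =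
      ((Complex.normSq p - r ^ 2 / 4 : ℝ) : ℂ) • (1 : Matrix B B ℂ) := by
    have h1 : p • (Xᴴ * Y) = (r : ℂ) • (1 : Matrix B B ℂ) - star p • (Yᴴ * X) :=
      eq_sub_of_add_eq hrel
    have hYX : (Xᴴ * Y) * (Yᴴ * X) = 1 := by
      rw [Matrix.mul_assoc, ← Matrix.mul_assoc Y,
        show Y * Yᴴ = 1 from mem_unitaryGroup_iff.1 hY, Matrix.one_mul, hX1]
    have hsq : (p • (Xᴴ * Y)) * (p • (Xᴴ * Y)) =
        (r : ℂ) • (p • (Xᴴ * Y)) - (star p * p) • (1 : Matrix B B ℂ) := by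
      conv_lhs => rw [h1]
      conv_lhs => arg 1; rw [← h1]
      rw [Matrix.mul_sub, Matrix.smul_mul, Matrix.smul_mul, Matrix.mul_smul, Matrix.mul_smul,
        hYX, Matrix.mul_one]
      module
    have hnp : (Complex.normSq p : ℂ) = star p * p := Complex.normSq_eq_conj_mul_self
    have hI : (-Complex.I) * (-Complex.I) = -1 := by simp
    rw [Matrix.smul_mul, Matrix.mul_smul, smul_smul, hI]
    simp only [Matrix.sub_mul, Matrix.mul_sub, hsq]
    push_cast
    rw [hnp]
    simp only [Matrix.smul_mul, Matrix.mul_smul, Matrix.one_mul, Matrix.mul_one]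
    module
  obtain ⟨F, s, hF, hFF, hKF⟩ := exists_projection_of_sq_eq_smul hK hKK
  refine ⟨F, p⁻¹ * (r / 2 + Complex.I * s), p⁻¹ * (r / 2 - Complex.I * s), hF, hFF, ?_⟩
  have h1 : p • (Xᴴ * Y) = ((r : ℂ) / 2) • (1 : Matrix B B ℂ) +
      Complex.I • (s • F - s • (1 - F)) := by
    rw [← hKF, smul_smul, mul_neg, Complex.I_mul_I, neg_neg, one_smul]
    abel
  have h2 : Xᴴ * Y = p⁻¹ • (((r : ℂ) / 2) • (1 : Matrix B B ℂ) +
      Complex.I • (s • F - s • (1 - F))) := by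
    rw [← h1, smul_smul, inv_mul_cancel₀ hp0, one_smul]
  have h3 : Y = X * (Xᴴ * Y) := by rw [← Matrix.mul_assoc, hX2, Matrix.one_mul]
  rw [h3, h2]
  congr 1
  module

/-- A unitary of the form `G (x F + y (1 - F))`, with a projection `F`, has such a form with `x` and
`y` of modulus one. -/
theorem exists_unimodular_of_mem_unitaryGroup {B : Type} [Fintype B] [DecidableEq B]
    {G F : Matrix B B ℂ} (hG : G ∈ unitaryGroup B ℂ) (hF : Fᴴ = F) (hFF : F * F = F) {x y : ℂ}
    (h : G * (x • F + y • (1 - F)) ∈ unitaryGroup B ℂ) :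
    ∃ x' y' : ℂ, star x' * x' = 1 ∧ star y' * y' = 1 ∧
      G * (x • F + y • (1 - F)) = G * (x' • F + y' • (1 - F)) := by
  have hG1 : Gᴴ * G = 1 := mem_unitaryGroup_iff'.1 hG
  have hF0 : F * (1 - F) = 0 := by rw [Matrix.mul_sub, hFF, Matrix.mul_one, sub_self]
  have hF0' : (1 - F) * F = 0 := by rw [Matrix.sub_mul, hFF, Matrix.one_mul, sub_self]
  have hF1 : (1 - F) * (1 - F) = 1 - F := by
    rw [Matrix.mul_sub, hF0', sub_zero, Matrix.mul_one]
  have h1 : (star x * x) • F + (star y * y) • (1 - F) = 1 := by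
    have : (G * (x • F + y • (1 - F)))ᴴ * (G * (x • F + y • (1 - F))) = 1 :=
      mem_unitaryGroup_iff'.1 h
    rw [conjTranspose_mul, Matrix.mul_assoc, ← Matrix.mul_assoc Gᴴ, hG1, Matrix.one_mul,
      conjTranspose_add, conjTranspose_smul, conjTranspose_smul, conjTranspose_sub,
      conjTranspose_one, hF] at this
    simpa only [Matrix.add_mul, Matrix.mul_add, Matrix.smul_mul, Matrix.mul_smul, hFF, hF0, hF0',
      hF1, smul_zero, add_zero, zero_add, smul_smul, mul_comm x,
      mul_comm y] using this
  have hx : (star x * x) • F = F := by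
    have := congrArg (F * ·) h1
    simpa only [Matrix.mul_add, Matrix.mul_smul, hFF, hF0, smul_zero, add_zero, Matrix.mul_one]
      using this
  have hy : (star y * y) • (1 - F) = 1 - F := by
    have := congrArg ((1 - F) * ·) h1
    simpa only [Matrix.mul_add, Matrix.mul_smul, hF1, hF0', smul_zero, zero_add, Matrix.mul_one]
      using this
  have key : ∀ (z : ℂ) (P : Matrix B B ℂ), (star z * z) • P = P →
      ∃ z' : ℂ, star z' * z' = 1 ∧ z • P = z' • P := by
    intro z P hz
    by_cases h : star z * z = 1
    · exact ⟨z, h, rfl⟩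
    · refine ⟨1, by simp, ?_⟩
      have h0 : (star z * z - 1) • P = 0 := by rw [sub_smul, hz, one_smul, sub_self]
      rw [(smul_eq_zero.1 h0).resolve_left (sub_ne_zero.2 h), smul_zero, smul_zero]
  obtain ⟨x', hx', hxF⟩ := key x F hx
  obtain ⟨y', hy', hyF⟩ := key y (1 - F) hy
  exact ⟨x', y', hx', hy', by rw [hxF, hyF]⟩

/-! ### Three unitaries with a unitary linear combination -/

section threeUnitaries

open scoped InnerProductSpace

/-- If `α + x + y = w`, where `x`, `y` and `w` are multiples of unitaries with the adjoints `x'`,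
`y'` and `w'`, then `α + x = w - y` is normal. Both expressions for its modulus give that `x + x'`
commutes with `y`. -/
theorem commute_add_of_add_add_eq {R : Type*} [Ring R] [Algebra ℂ R] {x x' y y' w w' : R}
    {α β γ δ : ℂ} (hα : α ≠ 0) (hx : x' * x = β • 1) (hx' : x * x' = β • 1)
    (hy : y' * y = γ • 1) (hy' : y * y' = γ • 1) (hw : w' * w = δ • 1) (hw' : w * w' = δ • 1)
    (h : α • 1 + x + y = w) (h' : α • 1 + x' + y' = w') : Commute (x + x') y := by
  have h1 : (w - y) * (w' - y') = (α * α + β) • 1 + α • (x + x') := by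
    rw [← h, ← h', add_sub_cancel_right, add_sub_cancel_right]
    simp only [add_mul, mul_add, hx', smul_mul_assoc, mul_smul_comm, one_mul, mul_one]
    module
  have h2 : (w' - y') * (w - y) = (α * α + β) • 1 + α • (x + x') := by
    rw [← h, ← h', add_sub_cancel_right, add_sub_cancel_right]
    simp only [add_mul, mul_add, hx, smul_mul_assoc, mul_smul_comm, one_mul, mul_one]
    module
  have h3 : (w - y) * (w' - y') * y = δ • y - γ • w - y * w' * y + γ • y := by
    have : (w - y) * (w' - y') * y = (w * w') * y - w * (y' * y) - y * w' * y + (y * y') * y := by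
      noncomm_ring
    rw [this, hw', hy, hy']
    simp only [smul_mul_assoc, mul_smul_comm, one_mul, mul_one]
  have h4 : y * ((w' - y') * (w - y)) = δ • y - γ • w - y * w' * y + γ • y := by
    have : y * ((w' - y') * (w - y)) = y * (w' * w) - (y * y') * w - y * w' * y + y * (y' * y) := by
      noncomm_ring
    rw [this, hw, hy, hy']
    simp only [smul_mul_assoc, mul_smul_comm, one_mul, mul_one]
  rw [h1] at h3
  rw [h2] at h4
  have h5 := h3.trans h4.symm
  simp only [add_mul _ _ y, mul_add y ((α * α + β) • 1), smul_mul_assoc, mul_smul_comm, one_mul,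
    mul_one] at h5
  have h6 := add_left_cancel h5
  have h7 : α • (x * y + x' * y - y * (x + x')) = 0 := by
    rw [smul_sub, h6, sub_self]
  rw [Commute, SemiconjBy, add_mul]
  exact sub_eq_zero.1 ((smul_eq_zero.1 h7).resolve_left hα)

theorem exists_mem_eigenvector {E : Type*} [AddCommGroup E] [Module ℂ E] [FiniteDimensional ℂ E]
    (f : Module.End ℂ E) {K : Submodule ℂ E} (hK : K ≠ ⊥) (hf : ∀ v ∈ K, f v ∈ K) :
    ∃ μ : ℂ, K ⊓ f.eigenspace μ ≠ ⊥ := by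
  have : Nontrivial K := Submodule.nontrivial_iff_ne_bot.2 hK
  obtain ⟨μ, hμ⟩ := Module.End.exists_eigenvalue (f.restrict hf)
  obtain ⟨v, hv⟩ := hμ.exists_hasEigenvector
  refine ⟨μ, (Submodule.ne_bot_iff _).2 ⟨v, ⟨v.2, ?_⟩, ?_⟩⟩
  · rw [SetLike.mem_coe, Module.End.mem_eigenspace_iff]
    exact congrArg Subtype.val hv.apply_eq_smul
  · exact fun h => hv.2 (Subtype.ext h)

section blocks

variable {E : Type*} [NormedAddCommGroup E] [InnerProductSpace ℂ E] [FiniteDimensional ℂ E]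
  {f f' g g' : Module.End ℂ E}

/-- Let `v` be a common eigenvector of the central elements `f + f'` and `g + g'` and of `f`. The
relations allow `f (g v)` and `g (g v)` to be expressed by `v` and `g v`, so the span of `v` and
`g v` is invariant. -/
theorem exists_invariant_finrank_le_two {β γ e₀ e₁ e₂ : ℂ} (hf : f' * f = β • 1)
    (hf' : f * f' = β • 1) (hg : g' * g = γ • 1) (hg' : g * g' = γ • 1)
    (hfg : Commute (f + f') g) (hfg' : Commute (f + f') g') (hgf : Commute (g + g') f)
    (he : f' * g + g' * f = e₀ • 1 + e₁ • (f + f') + e₂ • (g + g'))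
    {K : Submodule ℂ E} (hK : K ≠ ⊥)
    (hKf : ∀ v ∈ K, f v ∈ K ∧ f' v ∈ K ∧ g v ∈ K ∧ g' v ∈ K) :
    ∃ L ≤ K, L ≠ ⊥ ∧ Module.finrank ℂ L ≤ 2 ∧
      ∀ v ∈ L, f v ∈ L ∧ f' v ∈ L ∧ g v ∈ L ∧ g' v ∈ L := by
  have hff : Commute (f + f') f := by
    rw [Commute, SemiconjBy, add_mul, mul_add, hf, hf']
  have hgg : Commute (g + g') g := by
    rw [Commute, SemiconjBy, add_mul, mul_add, hg, hg']
  have happ : ∀ {p q : Module.End ℂ E}, Commute p q → ∀ v, p (q v) = q (p v) :=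
    fun h v => LinearMap.congr_fun h v
  obtain ⟨c, hc⟩ := exists_mem_eigenvector (f + f') hK
    fun v hv => K.add_mem (hKf v hv).1 (hKf v hv).2.1
  obtain ⟨d, hd⟩ := exists_mem_eigenvector (g + g') hc fun v hv => by
    rw [Submodule.mem_inf, Module.End.mem_eigenspace_iff] at hv ⊢
    exact ⟨K.add_mem (hKf v hv.1).2.2.1 (hKf v hv.1).2.2.2, by
      rw [happ (hfg.add_right hfg'), hv.2, map_smul]⟩
  obtain ⟨l, hl⟩ := exists_mem_eigenvector f hd fun v hv => by
    simp only [Submodule.mem_inf, Module.End.mem_eigenspace_iff] at hv ⊢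
    exact ⟨⟨(hKf v hv.1.1).1, by rw [happ hff, hv.1.2, map_smul]⟩,
      by rw [happ hgf, hv.2, map_smul]⟩
  obtain ⟨v, hv, hv0⟩ := (Submodule.ne_bot_iff _).1 hl
  simp only [Submodule.mem_inf, Module.End.mem_eigenspace_iff] at hv
  obtain ⟨⟨⟨hvK, hvc⟩, hvd⟩, hvl⟩ := hv
  set L := Submodule.span ℂ {v, g v} with hL
  have hvL : v ∈ L := Submodule.subset_span (by simp)
  have hgvL : g v ∈ L := Submodule.subset_span (by simp)
  have hext : ∀ h : Module.End ℂ E, h v ∈ L → h (g v) ∈ L → ∀ w ∈ L, h w ∈ L := by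
    intro h h1 h2
    have : L ≤ L.comap h := by
      rw [hL, Submodule.span_le]
      rintro w (rfl | rfl)
      · exact h1
      · exact h2
    exact this
  have hcL : ∀ w ∈ L, (f + f') w ∈ L := hext _ (by rw [hvc]; exact L.smul_mem _ hvL)
    (by rw [happ hfg, hvc, map_smul]; exact L.smul_mem _ hgvL)
  have hdL : ∀ w ∈ L, (g + g') w ∈ L := hext _ (by rw [hvd]; exact L.smul_mem _ hvL)
    (by rw [happ hgg, hvd, map_smul]; exact L.smul_mem _ hgvL)
  have hgL : ∀ w ∈ L, g w ∈ L := by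
    refine hext _ hgvL ?_
    have h1 : g' (g v) = γ • v := by simpa using LinearMap.congr_fun hg v
    have h2 : g (g v) = (g + g') (g v) - g' (g v) := by simp
    rw [h2, h1]
    exact L.sub_mem (hdL _ hgvL) (L.smul_mem _ hvL)
  have hg'L : ∀ w ∈ L, g' w ∈ L := fun w hw => by
    have h2 : g' w = (g + g') w - g w := by simp
    rw [h2]
    exact L.sub_mem (hdL _ hw) (hgL _ hw)
  have hfL : ∀ w ∈ L, f w ∈ L := by
    refine hext _ (by rw [hvl]; exact L.smul_mem _ hvL) ?_
    have h1 : f' (g v) + l • g' v = e₀ • v + e₁ • (c • v) + e₂ • (d • v) := by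
      have := LinearMap.congr_fun he v
      rw [← hvc, ← hvd, ← map_smul g', ← hvl]
      simpa using this
    have h2 : f (g v) = (f + f') (g v) -
        ((e₀ • v + e₁ • (c • v) + e₂ • (d • v)) - l • g' v) := by
      rw [← h1]
      simp
    rw [h2]
    exact L.sub_mem (hcL _ hgvL) (L.sub_mem (L.add_mem (L.add_mem (L.smul_mem _ hvL)
      (L.smul_mem _ (L.smul_mem _ hvL))) (L.smul_mem _ (L.smul_mem _ hvL)))
      (L.smul_mem _ (hg'L _ hvL)))
  refine ⟨L, ?_, (Submodule.ne_bot_iff _).2 ⟨v, hvL, hv0⟩, ?_, fun w hw => ⟨hfL w hw, ?_,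
    hgL w hw, hg'L w hw⟩⟩
  · rw [hL, Submodule.span_le]
    rintro w (rfl | rfl)
    · exact hvK
    · exact (hKf _ hvK).2.2.1
  · classical
    have := finrank_span_finset_le_card (R := ℂ) ({v, g v} : Finset E)
    rw [Finset.coe_pair] at this
    exact this.trans Finset.card_le_two
  · have h2 : f' w = (f + f') w - f w := by simp
    rw [h2]
    exact L.sub_mem (hcL _ hw) (hfL _ hw)

/-- If every nonzero invariant subspace contains an invariant subspace of dimension one or two, then
an invariant subspace has an orthonormal basis in which `f` and `g` only connect basis vectors that
are paired by an involution. -/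
theorem exists_orthonormal_paired
    (hf : ∀ x y, ⟪f x, y⟫_ℂ = ⟪x, f' y⟫_ℂ) (hg : ∀ x y, ⟪g x, y⟫_ℂ = ⟪x, g' y⟫_ℂ)
    (hfg : ∀ K : Submodule ℂ E, K ≠ ⊥ → (∀ v ∈ K, f v ∈ K ∧ f' v ∈ K ∧ g v ∈ K ∧ g' v ∈ K) →
      ∃ L ≤ K, L ≠ ⊥ ∧ Module.finrank ℂ L ≤ 2 ∧
        ∀ v ∈ L, f v ∈ L ∧ f' v ∈ L ∧ g v ∈ L ∧ g' v ∈ L) (n : ℕ)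
    (K : Submodule ℂ E) (hn : Module.finrank ℂ K = n)
    (hKf : ∀ v ∈ K, f v ∈ K ∧ f' v ∈ K ∧ g v ∈ K ∧ g' v ∈ K) :
    ∃ (ι : Type) (_ : Fintype ι) (b : ι → E) (σ : Equiv.Perm ι), Fintype.card ι = n ∧
      Orthonormal ℂ b ∧ (∀ i, b i ∈ K) ∧ (∀ i, σ (σ i) = i) ∧
      ∀ i k, k ≠ i → k ≠ σ i → ⟪b k, f (b i)⟫_ℂ = 0 ∧ ⟪b k, g (b i)⟫_ℂ = 0 := by
  induction n using Nat.strong_induction_on generalizing K with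
  | _ n ih =>
  have hf' : ∀ x y, ⟪f' x, y⟫_ℂ = ⟪x, f y⟫_ℂ := fun x y => by
    rw [← inner_conj_symm, ← hf, inner_conj_symm]
  have hg' : ∀ x y, ⟪g' x, y⟫_ℂ = ⟪x, g y⟫_ℂ := fun x y => by
    rw [← inner_conj_symm, ← hg, inner_conj_symm]
  rcases eq_or_ne K ⊥ with rfl | hK
  · rw [finrank_bot] at hn
    subst hn
    exact ⟨Empty, inferInstance, Empty.elim, Equiv.refl _, rfl,
      ⟨fun i => i.elim, fun i => i.elim⟩, fun i => i.elim, fun i => i.elim, fun i => i.elim⟩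
  · obtain ⟨L, hLK, hL0, hL2, hLf⟩ := hfg K hK hKf
    have hdim := Submodule.finrank_add_inf_finrank_orthogonal hLK
    have hpos : 0 < Module.finrank ℂ L := by
      have : Nontrivial L := Submodule.nontrivial_iff_ne_bot.2 hL0
      exact Module.finrank_pos
    have hK'f : ∀ v ∈ Lᗮ ⊓ K, f v ∈ Lᗮ ⊓ K ∧ f' v ∈ Lᗮ ⊓ K ∧ g v ∈ Lᗮ ⊓ K ∧ g' v ∈ Lᗮ ⊓ K := by
      rintro v ⟨hv, hvK⟩
      obtain ⟨h1, h2, h3, h4⟩ := hKf v hvK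
      rw [SetLike.mem_coe, Submodule.mem_orthogonal] at hv
      refine ⟨⟨(Submodule.mem_orthogonal _ _).2 fun w hw => ?_, h1⟩,
        ⟨(Submodule.mem_orthogonal _ _).2 fun w hw => ?_, h2⟩,
        ⟨(Submodule.mem_orthogonal _ _).2 fun w hw => ?_, h3⟩,
        ⟨(Submodule.mem_orthogonal _ _).2 fun w hw => ?_, h4⟩⟩
      · rw [← hf']; exact hv _ (hLf w hw).2.1
      · rw [← hf]; exact hv _ (hLf w hw).1
      · rw [← hg']; exact hv _ (hLf w hw).2.2.2
      · rw [← hg]; exact hv _ (hLf w hw).2.2.1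
    obtain ⟨ι, _, b, σ, hcard, hb, hbK, hσ, hbf⟩ :=
      ih (Module.finrank ℂ (Lᗮ ⊓ K : Submodule ℂ E)) (by omega) (Lᗮ ⊓ K) rfl hK'f
    have hbL : ∀ i, ∀ w ∈ L, ⟪w, b i⟫_ℂ = 0 := fun i =>
      (Submodule.mem_orthogonal _ _).1 (hbK i).1
    let c := stdOrthonormalBasis ℂ L
    refine ⟨ι ⊕ Fin (Module.finrank ℂ L), inferInstance, Sum.elim b fun i => (c i : E),
      Equiv.sumCongr σ Fin.revPerm, ?_, ?_, ?_, ?_, ?_⟩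
    · rw [Fintype.card_sum, hcard, Fintype.card_fin]
      omega
    · classical
      rw [orthonormal_iff_ite] at hb ⊢
      rintro (i | i) (k | k)
      · simpa using hb i k
      · simpa using inner_eq_zero_symm.1 (hbL i _ (c k).2)
      · simpa using hbL k _ (c i).2
      · have := orthonormal_iff_ite.1 c.orthonormal i k
        simpa using this
    · rintro (i | i)
      · exact (hbK i).2
      · exact hLK (c i).2
    · rintro (i | i)
      · simp [hσ]
      · simp
    · rintro (i | i) (k | k) h1 h2
      · exact hbf i k (fun h => h1 (by rw [h])) (fun h => h2 (by rw [h]; rfl))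
      · exact ⟨(Submodule.mem_orthogonal _ _).1 (hK'f _ (hbK i)).1.1 _ (c k).2,
          (Submodule.mem_orthogonal _ _).1 (hK'f _ (hbK i)).2.2.1.1 _ (c k).2⟩
      · exact ⟨inner_eq_zero_symm.1 (hbL k _ (hLf _ (c i).2).1),
          inner_eq_zero_symm.1 (hbL k _ (hLf _ (c i).2).2.2.1)⟩
      · exfalso
        have h1' : (k : ℕ) ≠ i := fun h => h1 (by rw [Fin.ext h])
        have h2' : (k : ℕ) ≠ Fin.rev i := fun h => h2 (by rw [Fin.ext h]; rfl)
        rw [Fin.val_rev] at h2'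
        have := i.2
        have := k.2
        omega

end blocks

/-- The action of matrices on Euclidean space, as a homomorphism of algebras. -/
noncomputable def euclideanAction (d : ℕ) :
    Matrix (Fin d) (Fin d) ℂ →ₐ[ℂ] Module.End ℂ (EuclideanSpace ℂ (Fin d)) :=
  (Matrix.toLpLinAlgEquiv 2).toAlgHom

theorem euclideanAction_apply {d : ℕ} (A : Matrix (Fin d) (Fin d) ℂ)
    (x : EuclideanSpace ℂ (Fin d)) (i : Fin d) : euclideanAction d A x i = ∑ k, A i k * x k := by
  rfl

theorem inner_euclideanAction {d : ℕ} (A : Matrix (Fin d) (Fin d) ℂ)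
    (x y : EuclideanSpace ℂ (Fin d)) :
    ⟪euclideanAction d A x, y⟫_ℂ = ⟪x, euclideanAction d Aᴴ y⟫_ℂ := by
  simp only [PiLp.inner_apply, euclideanAction_apply, RCLike.inner_apply, map_sum, map_mul,
    Finset.mul_sum, Finset.sum_mul, conjTranspose_apply, RCLike.star_def]
  rw [Finset.sum_comm]
  exact Finset.sum_congr rfl fun i _ => Finset.sum_congr rfl fun k _ => by ring

theorem smul_mul_smul_of_mem_unitaryGroup {d : ℕ} {V : Matrix (Fin d) (Fin d) ℂ}
    (hV : V ∈ unitaryGroup (Fin d) ℂ) (p : ℂ) :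
    (p • V)ᴴ * (p • V) = (star p * p) • 1 ∧ (p • V) * (p • V)ᴴ = (star p * p) • 1 := by
  have h1 : Vᴴ * V = 1 := mem_unitaryGroup_iff'.1 hV
  have h2 : V * Vᴴ = 1 := mem_unitaryGroup_iff.1 hV
  simp only [conjTranspose_smul, Matrix.smul_mul, Matrix.mul_smul, h1, h2, smul_smul]
  exact ⟨by rw [mul_comm], trivial⟩

/-- If `1`, `V` and `W` have a unitary linear combination without vanishing coefficients, then there
is an orthonormal basis in which `V` and `W` are block diagonal with blocks of size at most two. -/
theorem exists_unitary_paired {d : ℕ} {V W : Matrix (Fin d) (Fin d) ℂ}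
    (hV : V ∈ unitaryGroup (Fin d) ℂ) (hW : W ∈ unitaryGroup (Fin d) ℂ) {a b c : ℂ}
    (ha : a ≠ 0) (hb : b ≠ 0) (hc : c ≠ 0)
    (h : a • (1 : Matrix (Fin d) (Fin d) ℂ) + b • V + c • W ∈ unitaryGroup (Fin d) ℂ) :
    ∃ Q ∈ unitaryGroup (Fin d) ℂ, ∃ σ : Equiv.Perm (Fin d), (∀ i, σ (σ i) = i) ∧
      ∀ i k, k ≠ i → k ≠ σ i → (Qᴴ * V * Q) k i = 0 ∧ (Qᴴ * W * Q) k i = 0 := by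
  set p := star a * b with hp
  set q := star a * c with hq
  have hp0 : p ≠ 0 := mul_ne_zero (star_ne_zero.2 ha) hb
  have hq0 : q ≠ 0 := mul_ne_zero (star_ne_zero.2 ha) hc
  set α := star a * a with hα
  have hα0 : α ≠ 0 := mul_ne_zero (star_ne_zero.2 ha) ha
  obtain ⟨hx, hx'⟩ := smul_mul_smul_of_mem_unitaryGroup hV p
  obtain ⟨hy, hy'⟩ := smul_mul_smul_of_mem_unitaryGroup hW q
  obtain ⟨hw, hw'⟩ := smul_mul_smul_of_mem_unitaryGroup h (star a)
  set x := p • V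
  set y := q • W
  set w := star a • (a • (1 : Matrix (Fin d) (Fin d) ℂ) + b • V + c • W) with hwdef
  have hsum : α • 1 + x + y = w := by
    rw [hwdef, smul_add, smul_add, smul_smul, smul_smul, smul_smul]
  have hsum' : α • 1 + xᴴ + yᴴ = wᴴ := by
    have hαs : star α = α := by rw [hα, star_mul', star_star, mul_comm]
    rw [← hsum, conjTranspose_add, conjTranspose_add, conjTranspose_smul α, conjTranspose_one, hαs]
  have hxy := commute_add_of_add_add_eq hα0 hx hx' hy hy' hw hw' hsum hsum'
  have hxy' := commute_add_of_add_add_eq hα0 hx' hx hy' hy hw' hw hsum' hsum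
  rw [add_comm xᴴ] at hxy'
  have hyx := commute_add_of_add_add_eq hα0 hy hy' hx hx' hw hw'
    (by rw [← hsum]; abel) (by rw [← hsum']; abel)
  -- The product `wᴴ w` is a scalar, which determines the Hermitian part of `xᴴ y`.
  have he : xᴴ * y + yᴴ * x =
      (star (star a) * star a - α * α - star p * p - star q * q) • 1 + (-α) • (x + xᴴ) +
        (-α) • (y + yᴴ) := by
    rw [← hsum', ← hsum] at hw
    simp only [Matrix.add_mul, Matrix.mul_add, Matrix.smul_mul, Matrix.mul_smul, Matrix.one_mul,
      Matrix.mul_one, hx, hy] at hw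
    rw [← sub_eq_zero] at hw ⊢
    rw [← hw]
    module
  let φ := euclideanAction d
  have hφ : ∀ {A A' : Matrix (Fin d) (Fin d) ℂ} {β : ℂ}, A * A' = β • 1 →
      φ A * φ A' = β • 1 := fun h => by rw [← map_mul, h, map_smul, map_one]
  have hφc : ∀ {A A' A'' : Matrix (Fin d) (Fin d) ℂ}, Commute (A + A') A'' →
      Commute (φ A + φ A') (φ A'') := fun h => by
    rw [← map_add]; exact h.map φ
  have hφe := congrArg φ he
  simp only [map_add, map_mul, map_smul, map_one] at hφe
  obtain ⟨ι, _, e, σ, hcard, he1, -, hσ, heσ⟩ := exists_orthonormal_paired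
    (f := φ x) (f' := φ xᴴ) (g := φ y) (g' := φ yᴴ)
    (inner_euclideanAction x) (inner_euclideanAction y)
    (fun K hK hKf => exists_invariant_finrank_le_two (hφ hx) (hφ hx') (hφ hy) (hφ hy') (hφc hxy)
      (hφc hxy') (hφc hyx) hφe hK hKf) d ⊤ (by simp)
    (fun v _ => ⟨trivial, trivial, trivial, trivial⟩)
  obtain ⟨s⟩ : Nonempty (Fin d ≃ ι) := ⟨Fintype.equivOfCardEq (by rw [hcard, Fintype.card_fin])⟩
  let Q : Matrix (Fin d) (Fin d) ℂ := Matrix.of fun r i => e (s i) r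
  have hQA : ∀ (A : Matrix (Fin d) (Fin d) ℂ) (k i : Fin d),
      (Qᴴ * A * Q) k i = ⟪e (s k), φ A (e (s i))⟫_ℂ := by
    intro A k i
    rw [Matrix.mul_assoc]
    simp only [PiLp.inner_apply, φ, euclideanAction_apply, RCLike.inner_apply, mul_apply,
      conjTranspose_apply, Q, of_apply, RCLike.star_def]
    exact Finset.sum_congr rfl fun r _ => mul_comm _ _
  refine ⟨Q, ?_, (s.trans σ).trans s.symm, fun i => by simp [hσ], fun i k hki hkσ => ?_⟩
  · classical
    rw [mem_unitaryGroup_iff']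
    ext k i
    have := hQA 1 k i
    rw [Matrix.mul_one, map_one, Module.End.one_apply,
      orthonormal_iff_ite.1 he1 (s k) (s i)] at this
    rw [star_eq_conjTranspose, this]
    simp [one_apply]
  · obtain ⟨h1, h2⟩ := heσ (s i) (s k) (fun h => hki (s.injective h))
      (fun h => hkσ (by simp [← h]))
    rw [← hQA, Matrix.mul_smul, Matrix.smul_mul, Matrix.smul_apply] at h1 h2
    exact ⟨(smul_eq_zero.1 h1).resolve_left hp0, (smul_eq_zero.1 h2).resolve_left hq0⟩

end threeUnitaries

/-! ### The protocol -/

/-- The character table of a cyclic group is a complex Hadamard matrix. -/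
theorem exists_complexHadamard (H : Type) [Fintype H] [DecidableEq H] [Nonempty H] :
    ∃ χ : H → H → ℂ, (∀ t s, star (χ t s) * χ t s = 1) ∧
      ∀ s s', ∑ t, star (χ t s) * χ t s' = if s = s' then (Fintype.card H : ℂ) else 0 := by
  have : NeZero (Fintype.card H) := ⟨Fintype.card_ne_zero⟩
  obtain ⟨e⟩ : Nonempty (H ≃ ZMod (Fintype.card H)) :=
    ⟨Fintype.equivOfCardEq (by rw [ZMod.card])⟩
  have hstar : ∀ x : ZMod (Fintype.card H),
      star (ZMod.stdAddChar x) = ZMod.stdAddChar (-x) := fun x => by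
    rw [AddChar.map_neg_eq_conj]; rfl
  have hmul : ∀ t s s' : H, star (ZMod.stdAddChar (e t * e s)) * ZMod.stdAddChar (e t * e s') =
      ZMod.stdAddChar (e t * (e s' - e s)) := fun t s s' => by
    rw [hstar, ← AddChar.map_add_eq_mul]
    congr 1
    ring
  refine ⟨fun t s => ZMod.stdAddChar (e t * e s), fun t s => ?_, fun s s' => ?_⟩
  · rw [hmul, sub_self, mul_zero, AddChar.map_zero_eq_one]
  · simp_rw [hmul]
    rw [e.sum_comp (fun x => ZMod.stdAddChar (x * (e s' - e s))),
      AddChar.sum_mulShift _ (ZMod.isPrimitive_stdAddChar _), ZMod.card]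
    simp only [sub_eq_zero, e.injective.eq_iff, eq_comm (a := s'), Nat.cast_ite, Nat.cast_zero]

/-- The isometry that adjoins the maximally entangled state of Schmidt rank `N`. -/
noncomputable def adjoinResource (A B : Type) [DecidableEq A] [DecidableEq B] (N : ℕ) :
    Matrix ((A × Fin N) × (B × Fin N)) (A × B) ℂ :=
  Matrix.of fun x y => if x.1.1 = y.1 ∧ x.2.1 = y.2 then maxEntangledState N (x.1.2, x.2.2) else 0

theorem withResource_eq {A B : Type} [Fintype A] [DecidableEq A] [Fintype B] [DecidableEq B]
    (N : ℕ) (ρ : Matrix (A × B) (A × B) ℂ) :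
    withResource N ρ = adjoinResource A B N * ρ * (adjoinResource A B N)ᴴ := by
  have h1 : ∀ (x : (A × Fin N) × (B × Fin N)) (a : A × B),
      adjoinResource A B N x a =
        if (x.1.1, x.2.1) = a then maxEntangledState N (x.1.2, x.2.2) else 0 := by
    rintro ⟨⟨a, i⟩, ⟨b, j⟩⟩ ⟨a', b'⟩
    simp [adjoinResource]
  ext x y
  simp only [mul_apply, conjTranspose_apply, h1, ite_mul, zero_mul, Finset.sum_ite_eq,
    Finset.mem_univ, if_true, apply_ite star, star_zero, mul_ite, mul_zero]
  simp only [withResource, of_apply]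
  ring

/-- Product Kraus operators meet the resource state in the sum of the products of their
components. -/
theorem kronecker_mul_adjoinResource {A B A' B' : Type} [Fintype A] [DecidableEq A] [Fintype B]
    [DecidableEq B] (N : ℕ)
    (α : Matrix A' (A × Fin N) ℂ) (β : Matrix B' (B × Fin N) ℂ) :
    (α ⊗ₖ β) * adjoinResource A B N = ((1 / Real.sqrt N : ℝ) : ℂ) •
      ∑ k, (Matrix.of fun x a => α x (a, k)) ⊗ₖ (Matrix.of fun y b => β y (b, k)) := by
  ext ⟨x, y⟩ ⟨a, b⟩
  simp only [mul_apply, Fintype.sum_prod_type, adjoinResource, maxEntangledState, of_apply,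
    kroneckerMap_apply, Matrix.smul_apply, Matrix.sum_apply, smul_eq_mul, Finset.mul_sum]
  rw [Finset.sum_eq_single a (fun c _ hc => by simp [hc]) (by simp)]
  refine Finset.sum_congr rfl fun k _ => ?_
  rw [Finset.sum_eq_single b (fun c _ hc => by simp [hc]) (by simp)]
  simp
  ring

section protocol

set_option linter.unusedSectionVars false

variable {A B K H : Type} [Fintype A] [DecidableEq A] [Fintype B] [DecidableEq B]
  [Fintype K] [DecidableEq K] [AddCommGroup K] [Fintype H] [DecidableEq H]

/-- Alice compares the block of her input with her share of the resource; the difference is `m`. -/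
def krausCompare {N : ℕ} (e : Fin N ≃ K × H) (κ : A → K) (Ra : Matrix A A ℂ) (m : K) :
    Matrix (A × H) (A × Fin N) ℂ :=
  Matrix.of fun x y => if x.2 = (e y.2).2 ∧ κ x.1 = (e y.2).1 + m then Ra x.1 y.1 else 0

/-- Bob shifts his share of the resource to the block of Alice's input, applies `R κ s`,
controlled by both of his registers, and measures the register `s` in the conjugate basis. -/
noncomputable def krausEncode {N : ℕ} (e : Fin N ≃ K × H) (χ : H → H → ℂ)
    (R : K → H → Matrix B B ℂ) (Sb : Matrix B B ℂ) (m : K) (t : H) :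
    Matrix (B × K) (B × Fin N) ℂ :=
  Matrix.of fun x y => if x.2 = (e y.2).1 + m then
    ((1 / Real.sqrt (Fintype.card H) : ℝ) : ℂ) * star (χ t (e y.2).2) *
      (R x.2 (e y.2).2 * Sb) x.1 y.1 else 0

/-- Alice removes the phases of Bob's outcome `t`, applies the matrices `M`, and measures. -/
def krausDecode (χ : H → H → ℂ) (M : H → H → A → ℂ) (t g : H) : Matrix A (A × H) ℂ :=
  Matrix.of fun x y => if x = y.1 then χ t y.2 * M g y.2 x else 0

/-- Bob undoes `Q κ g` and measures the block register in the conjugate basis. -/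
noncomputable def krausCorrect (χ : K → K → ℂ) (Q : K → H → Matrix B B ℂ) (Qb : Matrix B B ℂ)
    (g : H) (u : K) : Matrix B (B × K) ℂ :=
  Matrix.of fun x y => ((1 / Real.sqrt (Fintype.card K) : ℝ) : ℂ) * star (χ u y.2) *
    (Qb * (Q y.2 g)ᴴ) x y.1

/-- Alice removes the phases of Bob's outcome `u`. -/
def krausFinish (χ : K → K → ℂ) (κ : A → K) (Pa : Matrix A A ℂ) (u : K) : Matrix A A ℂ :=
  Pa * diagonal fun j => χ u (κ j)

theorem conjTranspose_mul_apply {X Y Z : Type} [Fintype X] (P : Matrix X Y ℂ) (Q : Matrix X Z ℂ)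
    (a : Y) (b : Z) : (Pᴴ * Q) a b = ∑ x, star (P x a) * Q x b := rfl

theorem conjTranspose_mul_apply_self {X : Type} [Fintype X] [DecidableEq X] {U : Matrix X X ℂ}
    (hU : U ∈ unitaryGroup X ℂ) (a b : X) :
    ∑ x, star (U x a) * U x b = if a = b then 1 else 0 := by
  have := congrFun (congrFun (mem_unitaryGroup_iff'.1 hU) a) b
  simpa [mul_apply, star_apply, one_apply] using this

/-! The Kraus operators of each step form an instrument. -/

theorem sum_krausCompare {N : ℕ} (e : Fin N ≃ K × H) (κ : A → K) {Ra : Matrix A A ℂ}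
    (hRa : Ra ∈ unitaryGroup A ℂ) :
    ∑ m, (krausCompare e κ Ra m)ᴴ * krausCompare e κ Ra m = 1 := by
  ext ⟨a, k⟩ ⟨a', k'⟩
  simp only [Matrix.sum_apply, conjTranspose_mul_apply, Fintype.sum_prod_type, krausCompare,
    of_apply]
  have hkey : ∀ (m : K) (x : A) (s : H),
      (star (if s = (e k).2 ∧ κ x = (e k).1 + m then Ra x a else 0) *
        (if s = (e k').2 ∧ κ x = (e k').1 + m then Ra x a' else 0)) =
      if s = (e k).2 then if m = κ x - (e k).1 then
        (if k = k' then star (Ra x a) * Ra x a' else 0) else 0 else 0 := by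
    intro m x s
    by_cases h1 : s = (e k).2
    · by_cases h2 : m = κ x - (e k).1
      · subst h2 h1
        by_cases h3 : k = k'
        · subst h3; simp
        · have : ¬ ((e k).2 = (e k').2 ∧ κ x = (e k').1 + (κ x - (e k).1)) := by
            rintro ⟨h, h'⟩
            apply h3
            apply e.injective
            refine Prod.ext ?_ h
            have : (e k').1 - (e k).1 = 0 := by
              rw [← sub_eq_zero.2 h'.symm]; abel
            exact (sub_eq_zero.1 this).symm
          simp [h3, this]
      · have : ¬ (κ x = (e k).1 + m) := fun h => h2 (by rw [h]; abel)
        simp [h2, this]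
    · simp [h1]
  simp only [hkey, Finset.sum_ite_eq', Finset.mem_univ, if_true]
  rw [Finset.sum_comm]
  simp only [Finset.sum_ite_eq', Finset.mem_univ, if_true]
  by_cases h3 : k = k'
  · subst h3
    simp only [if_true, conjTranspose_mul_apply_self hRa]
    simp [one_apply]
  · simp [h3, one_apply]

theorem inv_sqrt_mul_self (n : ℕ) :
    (((1 / Real.sqrt n : ℝ) : ℂ)) * ((1 / Real.sqrt n : ℝ) : ℂ) = (n : ℂ)⁻¹ := by
  rw [← Complex.ofReal_mul, div_mul_div_comm, Real.mul_self_sqrt (Nat.cast_nonneg n)]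
  push_cast
  simp

theorem sum_krausEncode {N : ℕ} (e : Fin N ≃ K × H) {χ : H → H → ℂ} [Nonempty H]
    (hχ : ∀ s s', ∑ t, star (χ t s) * χ t s' = if s = s' then (Fintype.card H : ℂ) else 0)
    {R : K → H → Matrix B B ℂ} {Sb : Matrix B B ℂ}
    (hR : ∀ k s, R k s ∈ unitaryGroup B ℂ) (hSb : Sb ∈ unitaryGroup B ℂ) (m : K) :
    ∑ t, (krausEncode e χ R Sb m t)ᴴ * krausEncode e χ R Sb m t = 1 := by
  ext ⟨b, k⟩ ⟨b', k'⟩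
  simp only [Matrix.sum_apply, conjTranspose_mul_apply,
    Fintype.sum_prod_type, krausEncode, of_apply]
  have hkey : ∀ (t : H) (x : B) (l : K),
      (star (if l = (e k).1 + m then ((1 / Real.sqrt (Fintype.card H) : ℝ) : ℂ) *
          star (χ t (e k).2) * (R l (e k).2 * Sb) x b else 0) *
        (if l = (e k').1 + m then ((1 / Real.sqrt (Fintype.card H) : ℝ) : ℂ) *
          star (χ t (e k').2) * (R l (e k').2 * Sb) x b' else 0)) =
      if l = (e k).1 + m then if (e k).1 = (e k').1 then
        (star (χ t (e k').2) * χ t (e k).2) * ((Fintype.card H : ℂ)⁻¹ *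
          (star ((R l (e k).2 * Sb) x b) * (R l (e k').2 * Sb) x b')) else 0 else 0 := by
    intro t x l
    by_cases h1 : l = (e k).1 + m
    · by_cases h2 : (e k).1 = (e k').1
      · rw [if_pos h1, if_pos (by rw [h1, h2]), if_pos h1, if_pos h2, ← inv_sqrt_mul_self]
        simp only [star_mul', RCLike.star_def, Complex.conj_ofReal]
        simp only [← RCLike.star_def, star_star]
        ring
      · have : ¬ (e k).1 + m = (e k').1 + m := fun h => h2 (add_right_cancel h)
        simp [h1, h2, this]
    · simp [h1]
  simp only [hkey, Finset.sum_ite_eq', Finset.mem_univ, if_true]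
  have hcard : (Fintype.card H : ℂ) ≠ 0 := Nat.cast_ne_zero.2 Fintype.card_ne_zero
  by_cases h2 : (e k).1 = (e k').1
  · simp only [h2, if_true]
    rw [Finset.sum_comm]
    simp only [← Finset.sum_mul, hχ]
    by_cases h3 : (e k).2 = (e k').2
    · obtain rfl : k = k' := e.injective (Prod.ext h2 h3)
      simp only [if_true]
      rw [← Finset.mul_sum, ← Finset.mul_sum,
        conjTranspose_mul_apply_self (mul_mem (hR _ _) hSb), ← mul_assoc, mul_inv_cancel₀ hcard]
      simp [one_apply]
    · have : k ≠ k' := fun h => h3 (by rw [h])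
      simp [Ne.symm h3, one_apply, this]
  · have : k ≠ k' := fun h => h2 (by rw [h])
    simp [h2, one_apply, this]

theorem sum_krausDecode {χ : H → H → ℂ} (hχ : ∀ t s, star (χ t s) * χ t s = 1)
    {M : H → H → A → ℂ}
    (hM : ∀ j h h', ∑ g, star (M g h j) * M g h' j = if h = h' then 1 else 0) (t : H) :
    ∑ g, (krausDecode χ M t g)ᴴ * krausDecode χ M t g = 1 := by
  ext ⟨a, s⟩ ⟨a', s'⟩
  simp only [Matrix.sum_apply, conjTranspose_mul_apply, krausDecode, of_apply]
  have hkey : ∀ (g : H) (x : A),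
      (star (if x = a then χ t s * M g s x else 0) * (if x = a' then χ t s' * M g s' x else 0)) =
      if x = a then if a = a' then
        (star (χ t s) * χ t s') * (star (M g s a) * M g s' a) else 0 else 0 := by
    intro g x
    by_cases h1 : x = a
    · subst h1
      by_cases h2 : x = a'
      · simp only [h2, if_true, star_mul']; ring
      · simp [h2]
    · simp [h1]
  simp only [hkey, Finset.sum_ite_eq', Finset.mem_univ, if_true]
  by_cases h2 : a = a'
  · subst h2
    simp only [if_true, ← Finset.mul_sum, hM]
    by_cases h3 : s = s'
    · subst h3; simp only [hχ, if_true]; simp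
    · simp [h3, one_apply]
  · simp [h2, one_apply]

theorem sum_krausCorrect {χ : K → K → ℂ}
    (hχ : ∀ s s', ∑ t, star (χ t s) * χ t s' = if s = s' then (Fintype.card K : ℂ) else 0)
    {Q : K → H → Matrix B B ℂ} {Qb : Matrix B B ℂ}
    (hQ : ∀ k s, Q k s ∈ unitaryGroup B ℂ) (hQb : Qb ∈ unitaryGroup B ℂ) (g : H) :
    ∑ u, (krausCorrect χ Q Qb g u)ᴴ * krausCorrect χ Q Qb g u = 1 := by
  ext ⟨b, k⟩ ⟨b', k'⟩
  simp only [Matrix.sum_apply, conjTranspose_mul_apply,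
    krausCorrect, of_apply]
  have hkey : ∀ (u : K) (x : B),
      (star (((1 / Real.sqrt (Fintype.card K) : ℝ) : ℂ) * star (χ u k) *
          (Qb * (Q k g)ᴴ) x b) *
        (((1 / Real.sqrt (Fintype.card K) : ℝ) : ℂ) * star (χ u k') *
          (Qb * (Q k' g)ᴴ) x b')) =
        (star (χ u k') * χ u k) * ((Fintype.card K : ℂ)⁻¹ *
          (star ((Qb * (Q k g)ᴴ) x b) * (Qb * (Q k' g)ᴴ) x b')) := by
    intro u x
    rw [← inv_sqrt_mul_self]
    simp only [star_mul', RCLike.star_def, Complex.conj_ofReal]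
    simp only [← RCLike.star_def, star_star]
    ring
  have hcard : (Fintype.card K : ℂ) ≠ 0 := Nat.cast_ne_zero.2 Fintype.card_ne_zero
  simp only [hkey, ← Finset.mul_sum, ← Finset.sum_mul, hχ]
  by_cases h3 : k = k'
  · subst h3
    have hQs : (Q k g)ᴴ ∈ unitaryGroup B ℂ := Unitary.star_mem (hQ k g)
    simp only [if_true]
    rw [conjTranspose_mul_apply_self (mul_mem hQb hQs), ← mul_assoc, mul_inv_cancel₀ hcard]
    simp [one_apply]
  · simp [h3, Ne.symm h3, one_apply]

theorem krausFinish_conjTranspose_mul {χ : K → K → ℂ} (hχ : ∀ t s, star (χ t s) * χ t s = 1)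
    (κ : A → K) {Pa : Matrix A A ℂ} (hPa : Pa ∈ unitaryGroup A ℂ) (u : K) :
    (krausFinish χ κ Pa u)ᴴ * krausFinish χ κ Pa u = 1 := by
  have h : Paᴴ * Pa = 1 := mem_unitaryGroup_iff'.1 hPa
  rw [krausFinish, conjTranspose_mul, Matrix.mul_assoc, ← Matrix.mul_assoc Paᴴ, h, Matrix.one_mul,
    diagonal_conjTranspose, diagonal_mul_diagonal, ← diagonal_one]
  congr 1
  funext j
  exact hχ _ _

theorem logb_card_mul [Nonempty H] : Real.logb 2 ((Fintype.card K * Fintype.card H : ℕ) : ℝ) =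
    Real.logb 2 (Fintype.card K) + Real.logb 2 (Fintype.card H) := by
  push_cast
  exact Real.logb_mul (Nat.cast_ne_zero.2 Fintype.card_ne_zero)
    (Nat.cast_ne_zero.2 Fintype.card_ne_zero)

/-- Alice's Kraus operators along one run, restricted to the component `k` of her share of the
resource. -/
theorem krausFinish_mul_krausDecode_mul_krausCompare {N : ℕ} (e : Fin N ≃ K × H) (κ : A → K)
    (χK : K → K → ℂ) (χH : H → H → ℂ) (M : H → H → A → ℂ) (Pa Ra : Matrix A A ℂ)
    (m u : K) (t g : H) (k : Fin N) :
    (Matrix.of fun x a => (krausFinish χK κ Pa u * (krausDecode χH M t g * krausCompare e κ Ra m))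
      x (a, k)) =
      Pa * (diagonal fun j => if κ j = (e k).1 + m then
        χK u ((e k).1 + m) * χH t (e k).2 * M g (e k).2 j else 0) * Ra := by
  ext x a
  rw [of_apply, krausFinish, Matrix.mul_assoc, Matrix.mul_assoc, mul_apply, mul_apply]
  refine Finset.sum_congr rfl fun j _ => ?_
  rw [diagonal_mul, diagonal_mul, mul_apply, Fintype.sum_prod_type]
  simp only [krausDecode, krausCompare, of_apply]
  rw [Finset.sum_eq_single j (fun c _ hc => by simp [Ne.symm hc]) (by simp)]
  rw [Finset.sum_eq_single (e k).2 (fun c _ hc => by simp [hc]) (by simp)]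
  by_cases h : κ j = (e k).1 + m
  · simp only [h, true_and, if_true]; ring
  · simp [h]

/-- Bob's Kraus operators along one run, restricted to the component `k` of his share of the
resource. -/
theorem krausCorrect_mul_krausEncode {N : ℕ} (e : Fin N ≃ K × H)
    (χK : K → K → ℂ) (χH : H → H → ℂ) (R Q : K → H → Matrix B B ℂ) (Qb Sb : Matrix B B ℂ)
    (m u : K) (t g : H) (k : Fin N) :
    (Matrix.of fun y b => (krausCorrect χK Q Qb g u * krausEncode e χH R Sb m t) y (b, k)) =
      (((1 / Real.sqrt (Fintype.card K) : ℝ) : ℂ) * ((1 / Real.sqrt (Fintype.card H) : ℝ) : ℂ) *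
        star (χK u ((e k).1 + m)) * star (χH t (e k).2)) •
      (Qb * ((Q ((e k).1 + m) g)ᴴ * R ((e k).1 + m) (e k).2) * Sb) := by
  have hassoc : Qb * ((Q ((e k).1 + m) g)ᴴ * R ((e k).1 + m) (e k).2) * Sb =
      (Qb * (Q ((e k).1 + m) g)ᴴ) * (R ((e k).1 + m) (e k).2 * Sb) := by
    simp only [Matrix.mul_assoc]
  rw [hassoc]
  ext y b
  rw [of_apply, Matrix.smul_apply, mul_apply, mul_apply, Fintype.sum_prod_type, smul_eq_mul,
    Finset.mul_sum]
  refine Finset.sum_congr rfl fun z _ => ?_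
  simp only [krausCorrect, krausEncode, of_apply]
  rw [Finset.sum_eq_single ((e k).1 + m) (fun c _ hc => by simp [hc]) (by simp)]
  rw [if_pos rfl]
  ring

/-- Each run of the protocol implements `U`, up to the same factor. -/
theorem kraus_run {N : ℕ} (e : Fin N ≃ K × H) {κ : A → K} {χK : K → K → ℂ} {χH : H → H → ℂ}
    (hχK : ∀ t s, star (χK t s) * χK t s = 1) (hχH : ∀ t s, star (χH t s) * χH t s = 1)
    {M : H → H → A → ℂ} {R Q : K → H → Matrix B B ℂ} {T : A → Matrix B B ℂ}
    (hQ : ∀ k s, Q k s ∈ unitaryGroup B ℂ)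
    (hMR : ∀ j g, ∑ h, M g h j • R (κ j) h = Q (κ j) g * T j)
    (Pa Ra : Matrix A A ℂ) (Qb Sb : Matrix B B ℂ) (m u : K) (t g : H) :
    ((krausFinish χK κ Pa u * (krausDecode χH M t g * krausCompare e κ Ra m)) ⊗ₖ
      (krausCorrect χK Q Qb g u * krausEncode e χH R Sb m t)) * adjoinResource A B N =
    (((1 / Real.sqrt N : ℝ) : ℂ) * (((1 / Real.sqrt (Fintype.card K) : ℝ) : ℂ) *
      ((1 / Real.sqrt (Fintype.card H) : ℝ) : ℂ))) •
      ((Pa ⊗ₖ Qb) * (∑ j, Matrix.single j j (1 : ℂ) ⊗ₖ T j) * (Ra ⊗ₖ Sb)) := by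
  have hV : (∑ j, Matrix.single j j (1 : ℂ) ⊗ₖ T j) =
      ∑ k : Fin N, (diagonal fun j => if κ j = (e k).1 + m then M g (e k).2 j else 0) ⊗ₖ
        ((Q ((e k).1 + m) g)ᴴ * R ((e k).1 + m) (e k).2) := by
    rw [← e.symm.sum_comp, Fintype.sum_prod_type]
    simp only [Equiv.apply_symm_apply]
    refine Eq.trans ?_ (Equiv.sum_comp (Equiv.addRight m) (fun c : K => ∑ s : H,
      (diagonal fun j => if κ j = c then M g s j else 0) ⊗ₖ ((Q c g)ᴴ * R c s))).symm
    ext ⟨x, y⟩ ⟨x', y'⟩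
    simp only [Matrix.sum_apply, kroneckerMap_apply]
    rw [Finset.sum_eq_single x (fun c _ hc => by simp [hc]) (by simp)]
    by_cases hx : x = x'
    · subst hx
      simp only [single_apply_same, one_mul, diagonal_apply_eq]
      rw [Finset.sum_eq_single (κ x) (fun c _ hc => by simp [Ne.symm hc]) (by simp)]
      have : T x = ∑ h, M g h x • ((Q (κ x) g)ᴴ * R (κ x) h) := by
        have hq : (Q (κ x) g)ᴴ * Q (κ x) g = 1 := mem_unitaryGroup_iff'.1 (hQ _ _)
        simp only [← Matrix.mul_smul]
        rw [← Matrix.mul_sum, hMR, ← Matrix.mul_assoc, hq, Matrix.one_mul]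
      conv_lhs => rw [this]
      simp [Matrix.sum_apply]
    · simp [hx]
  rw [kronecker_mul_adjoinResource, hV, Matrix.mul_sum, Matrix.sum_mul, Finset.smul_sum,
    Finset.smul_sum]
  refine Finset.sum_congr rfl fun k _ => ?_
  rw [krausFinish_mul_krausDecode_mul_krausCompare, krausCorrect_mul_krausEncode,
    ← mul_kronecker_mul, ← mul_kronecker_mul]
  have hd : (diagonal fun j => if κ j = (e k).1 + m then
        χK u ((e k).1 + m) * χH t (e k).2 * M g (e k).2 j else 0) =
      (χK u ((e k).1 + m) * χH t (e k).2) •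
        (diagonal fun j => if κ j = (e k).1 + m then M g (e k).2 j else 0) := by
    rw [← diagonal_smul]
    congr 1
    funext j
    simp
  rw [hd, Matrix.mul_smul, Matrix.smul_mul, smul_kronecker, kronecker_smul, smul_smul, smul_smul]
  congr 1
  linear_combination (((1 / Real.sqrt N : ℝ) : ℂ) * (((1 / Real.sqrt (Fintype.card K) : ℝ) : ℂ) *
    ((1 / Real.sqrt (Fintype.card H) : ℝ) : ℂ))) * (star (χH t (e k).2) * χH t (e k).2 *
      hχK u ((e k).1 + m) + hχH t (e k).2)

/-- A controlled unitary `∑ j, |j⟩⟨j| ⊗ T j` whose terms are sorted into blocks by `κ : A → K`, such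
that in each block the `T j` act on a family `R κ h` of unitaries through unitary matrices `M`, can
be implemented with a maximally entangled state of Schmidt rank `|K| |H|`. Alice shares the block
coherently with Bob, who then entangles his system with the label `h` by applying `R κ h`; Alice
applies the matrices `M`, which now has the effect of the `T j`; the labels are then measured in
such a way that nothing about the state is learned. -/
theorem implementableByLOCC_of_blocks {dA dB : ℕ} [Nonempty H]
    {U : Matrix (Fin dA × Fin dB) (Fin dA × Fin dB) ℂ} {T : Fin dA → Matrix (Fin dB) (Fin dB) ℂ}
    (hU : LocallyEquivalent U (∑ j, Matrix.single j j (1 : ℂ) ⊗ₖ T j))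
    {κ : Fin dA → K} {M : H → H → Fin dA → ℂ} {R Q : K → H → Matrix (Fin dB) (Fin dB) ℂ}
    (hR : ∀ k s, R k s ∈ unitaryGroup (Fin dB) ℂ) (hQ : ∀ k s, Q k s ∈ unitaryGroup (Fin dB) ℂ)
    (hM : ∀ j h h', ∑ g, star (M g h j) * M g h' j = if h = h' then 1 else 0)
    (hMR : ∀ j g, ∑ h, M g h j • R (κ j) h = Q (κ j) g * T j) :
    ImplementableByLOCC U (Real.logb 2 ((Fintype.card K * Fintype.card H : ℕ) : ℝ))
      (2 * Real.logb 2 ((Fintype.card K * Fintype.card H : ℕ) : ℝ)) := by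
  obtain ⟨Pa, Ra, Qb, Sb, hPa, hRa, hQb, hSb, rfl⟩ := hU
  obtain ⟨χK, hχK1, hχK⟩ := exists_complexHadamard K
  obtain ⟨χH, hχH1, hχH⟩ := exists_complexHadamard H
  set N := Fintype.card K * Fintype.card H with hN
  have hNpos : 0 < N := Nat.mul_pos Fintype.card_pos Fintype.card_pos
  obtain ⟨e⟩ : Nonempty (Fin N ≃ K × H) :=
    ⟨Fintype.equivOfCardEq (by rw [Fintype.card_fin, Fintype.card_prod])⟩
  refine ⟨N,
    .alice (Fin dA × H) K Unit (fun m _ => krausCompare e κ Ra m)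
      (by simpa using sum_krausCompare e κ hRa) fun m =>
    .bob (Fin dB × K) H Unit (fun t _ => krausEncode e χH R Sb m t)
      (by simpa using sum_krausEncode e hχH hR hSb m) fun t =>
    .alice (Fin dA) H Unit (fun g _ => krausDecode χH M t g)
      (by simpa using sum_krausDecode hχH1 hM t) fun g =>
    .bob (Fin dB) K Unit (fun u _ => krausCorrect χK Q Qb g u)
      (by simpa using sum_krausCorrect hχK hQ hQb g) fun u =>
    .alice (Fin dA) Unit Unit (fun _ _ => krausFinish χK κ Pa u)
      (by simpa using krausFinish_conjTranspose_mul hχK1 κ hPa u) fun _ => .done,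
    hNpos, le_rfl, ?_, fun ρ => ?_⟩
  · have hlog := logb_card_mul (K := K) (H := H)
    rw [← hN] at hlog
    simp only [LOCCProtocol.cbits, ciSup_const, Fintype.card_unit, Nat.cast_one, Real.logb_one]
    linarith
  · simp only [LOCCProtocol.channel, Finset.univ_unique, Finset.sum_singleton]
    have hrun : ∀ (m u : K) (t g : H),
        (krausFinish χK κ Pa u ⊗ₖ (1 : Matrix (Fin dB) (Fin dB) ℂ)) *
          (((1 : Matrix (Fin dA) (Fin dA) ℂ) ⊗ₖ krausCorrect χK Q Qb g u) *
            ((krausDecode χH M t g ⊗ₖ (1 : Matrix (Fin dB × K) (Fin dB × K) ℂ)) *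
              (((1 : Matrix (Fin dA × H) (Fin dA × H) ℂ) ⊗ₖ krausEncode e χH R Sb m t) *
                ((krausCompare e κ Ra m ⊗ₖ (1 : Matrix (Fin dB × Fin N) (Fin dB × Fin N) ℂ)) *
                  withResource N ρ *
                  (krausCompare e κ Ra m ⊗ₖ (1 : Matrix (Fin dB × Fin N) (Fin dB × Fin N) ℂ))ᴴ) *
                ((1 : Matrix (Fin dA × H) (Fin dA × H) ℂ) ⊗ₖ krausEncode e χH R Sb m t)ᴴ) *
              (krausDecode χH M t g ⊗ₖ (1 : Matrix (Fin dB × K) (Fin dB × K) ℂ))ᴴ) *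
            ((1 : Matrix (Fin dA) (Fin dA) ℂ) ⊗ₖ krausCorrect χK Q Qb g u)ᴴ) *
          (krausFinish χK κ Pa u ⊗ₖ (1 : Matrix (Fin dB) (Fin dB) ℂ))ᴴ =
        ((N : ℂ)⁻¹ * ((Fintype.card K : ℂ)⁻¹ * (Fintype.card H : ℂ)⁻¹)) •
          (((Pa ⊗ₖ Qb) * (∑ j, Matrix.single j j (1 : ℂ) ⊗ₖ T j) * (Ra ⊗ₖ Sb)) * ρ *
            ((Pa ⊗ₖ Qb) * (∑ j, Matrix.single j j (1 : ℂ) ⊗ₖ T j) * (Ra ⊗ₖ Sb))ᴴ) := by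
      intro m u t g
      have h := kraus_run e hχK1 hχH1 hQ hMR Pa Ra Qb Sb m u t g
      have hL : (krausFinish χK κ Pa u * (krausDecode χH M t g * krausCompare e κ Ra m)) ⊗ₖ
            (krausCorrect χK Q Qb g u * krausEncode e χH R Sb m t) =
          (krausFinish χK κ Pa u ⊗ₖ (1 : Matrix (Fin dB) (Fin dB) ℂ)) *
          (((1 : Matrix (Fin dA) (Fin dA) ℂ) ⊗ₖ krausCorrect χK Q Qb g u) *
            ((krausDecode χH M t g ⊗ₖ (1 : Matrix (Fin dB × K) (Fin dB × K) ℂ)) *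
              (((1 : Matrix (Fin dA × H) (Fin dA × H) ℂ) ⊗ₖ krausEncode e χH R Sb m t) *
                (krausCompare e κ Ra m ⊗ₖ
                  (1 : Matrix (Fin dB × Fin N) (Fin dB × Fin N) ℂ))))) := by
        simp only [← mul_kronecker_mul, Matrix.one_mul, Matrix.mul_one]
      rw [hL] at h
      rw [← inv_sqrt_mul_self, ← inv_sqrt_mul_self, ← inv_sqrt_mul_self, withResource_eq]
      generalize hW : (Pa ⊗ₖ Qb) * (∑ j, Matrix.single j j (1 : ℂ) ⊗ₖ T j) * (Ra ⊗ₖ Sb) = W at h ⊢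
      generalize hc : (((1 / Real.sqrt N : ℝ) : ℂ) * (((1 / Real.sqrt (Fintype.card K) : ℝ) : ℂ) *
        ((1 / Real.sqrt (Fintype.card H) : ℝ) : ℂ))) = c at h
      have hcc : star c = c := by
        rw [← hc]; simp only [star_mul', RCLike.star_def, Complex.conj_ofReal]
      have h' := congrArg conjTranspose h
      simp only [conjTranspose_mul, conjTranspose_smul, hcc] at h'
      have hfin : (c • W) * ρ * (c • Wᴴ) = (c * c) • (W * ρ * Wᴴ) := by
        simp only [Matrix.smul_mul, Matrix.mul_smul, smul_smul]
      have hcalc : (((1 / Real.sqrt N : ℝ) : ℂ) * ((1 / Real.sqrt N : ℝ) : ℂ) *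
          (((1 / Real.sqrt (Fintype.card K) : ℝ) : ℂ) *
            ((1 / Real.sqrt (Fintype.card K) : ℝ) : ℂ) *
            (((1 / Real.sqrt (Fintype.card H) : ℝ) : ℂ) *
              ((1 / Real.sqrt (Fintype.card H) : ℝ) : ℂ)))) = c * c := by
        rw [← hc]; ring
      rw [hcalc, ← hfin, ← h, ← h']
      simp only [Matrix.mul_assoc]
    simp only [hrun, Finset.sum_const, Finset.card_univ, ← Nat.cast_smul_eq_nsmul ℂ, smul_smul]
    have hK : (Fintype.card K : ℂ) ≠ 0 := Nat.cast_ne_zero.2 Fintype.card_ne_zero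
    have hH : (Fintype.card H : ℂ) ≠ 0 := Nat.cast_ne_zero.2 Fintype.card_ne_zero
    have : (Fintype.card K : ℂ) * ((Fintype.card H : ℂ) * ((Fintype.card H : ℂ) *
        ((Fintype.card K : ℂ) * ((N : ℂ)⁻¹ * ((Fintype.card K : ℂ)⁻¹ *
          (Fintype.card H : ℂ)⁻¹))))) = 1 := by
      rw [hN]
      push_cast
      field_simp
    simp only [mul_assoc] at this ⊢
    rw [this, one_smul]

end protocol

/-! ### Controlled unitaries -/

section controlled

variable {dA dB : ℕ}

/-- The operator `∑ j, |j⟩⟨j| ⊗ T j`. -/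
def controlled (T : Fin dA → Matrix (Fin dB) (Fin dB) ℂ) :
    Matrix (Fin dA × Fin dB) (Fin dA × Fin dB) ℂ :=
  ∑ j, Matrix.single j j (1 : ℂ) ⊗ₖ T j

theorem controlled_apply (T : Fin dA → Matrix (Fin dB) (Fin dB) ℂ) (x x' : Fin dA)
    (y y' : Fin dB) : controlled T (x, y) (x', y') = if x = x' then T x y y' else 0 := by
  simp only [controlled, Matrix.sum_apply, kroneckerMap_apply]
  rw [Finset.sum_eq_single x (fun c _ hc => by simp [hc]) (by simp)]
  by_cases h : x = x' <;> simp [h]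

theorem controlled_injective :
    Function.Injective (controlled : (Fin dA → Matrix (Fin dB) (Fin dB) ℂ) → _) := by
  intro T T' h
  funext j
  ext y y'
  simpa [controlled_apply] using congrFun (congrFun h (j, y)) (j, y')

theorem controlled_mul (T T' : Fin dA → Matrix (Fin dB) (Fin dB) ℂ) :
    controlled T * controlled T' = controlled fun j => T j * T' j := by
  ext ⟨x, y⟩ ⟨x', y'⟩
  simp only [mul_apply, Fintype.sum_prod_type, controlled_apply]
  rw [Finset.sum_eq_single x (fun c _ hc => by simp [Ne.symm hc]) (by simp)]
  by_cases h : x = x' <;> simp [h]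

theorem controlled_conjTranspose (T : Fin dA → Matrix (Fin dB) (Fin dB) ℂ) :
    (controlled T)ᴴ = controlled fun j => (T j)ᴴ := by
  ext ⟨x, y⟩ ⟨x', y'⟩
  simp only [conjTranspose_apply, controlled_apply]
  by_cases h : x = x'
  · simp [h]
  · simp [h, Ne.symm h]

theorem diagonal_kronecker_eq_controlled (w : Fin dA → ℂ) (Q : Matrix (Fin dB) (Fin dB) ℂ) :
    diagonal w ⊗ₖ Q = controlled fun j => w j • Q := by
  ext ⟨x, y⟩ ⟨x', y'⟩
  simp only [kroneckerMap_apply, controlled_apply]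
  by_cases h : x = x' <;> simp [h]

theorem one_kronecker_eq_controlled (Q : Matrix (Fin dB) (Fin dB) ℂ) :
    (1 : Matrix (Fin dA) (Fin dA) ℂ) ⊗ₖ Q = controlled fun _ => Q := by
  rw [← diagonal_one, diagonal_kronecker_eq_controlled]
  simp

theorem controlled_sum {n : ℕ} (T : Fin n → Fin dA → Matrix (Fin dB) (Fin dB) ℂ) :
    ∑ k, controlled (T k) = controlled fun j => ∑ k, T k j := by
  ext ⟨x, y⟩ ⟨x', y'⟩
  simp only [Matrix.sum_apply, controlled_apply]
  by_cases h : x = x' <;> simp [h]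

theorem mem_unitaryGroup_of_controlled {T : Fin dA → Matrix (Fin dB) (Fin dB) ℂ}
    (h : controlled T ∈ unitaryGroup (Fin dA × Fin dB) ℂ) (j : Fin dA) :
    T j ∈ unitaryGroup (Fin dB) ℂ := by
  have h1 : (controlled T)ᴴ * controlled T = 1 := mem_unitaryGroup_iff'.1 h
  rw [controlled_conjTranspose, controlled_mul, ← one_kronecker_one,
    one_kronecker_eq_controlled] at h1
  exact mem_unitaryGroup_iff'.2 (congrFun (controlled_injective h1) j)

end controlled

/-! ### Protocols for special controlled unitaries -/

/-- Any controlled unitary can be implemented by sharing the control register coherently. -/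
theorem implementableByLOCC_controlled {dA dB : ℕ} [NeZero dA]
    {U : Matrix (Fin dA × Fin dB) (Fin dA × Fin dB) ℂ} {T : Fin dA → Matrix (Fin dB) (Fin dB) ℂ}
    (hU : LocallyEquivalent U (controlled T)) (hT : ∀ j, T j ∈ unitaryGroup (Fin dB) ℂ) :
    ImplementableByLOCC U (Real.logb 2 dA) (2 * Real.logb 2 dA) := by
  have := implementableByLOCC_of_blocks (K := Fin dA) (H := Unit) hU (κ := id)
    (M := fun _ _ _ => 1) (R := fun k _ => T k) (Q := fun _ _ => 1) (fun k _ => hT k)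
    (fun _ _ => one_mem _) (fun _ _ _ => by simp) (fun j _ => by simp)
  simpa using this

theorem projection_add_smul_mem_unitaryGroup {B : Type} [Fintype B] [DecidableEq B]
    {F : Matrix B B ℂ} (hF : Fᴴ = F) (hFF : F * F = F) {s : ℂ} (hs : star s * s = 1) :
    F + s • (1 - F) ∈ unitaryGroup B ℂ := by
  rw [mem_unitaryGroup_iff', star_eq_conjTranspose, conjTranspose_add, conjTranspose_smul,
    conjTranspose_sub, conjTranspose_one, hF]
  simp only [Matrix.add_mul, Matrix.mul_add, Matrix.smul_mul, Matrix.mul_smul, Matrix.sub_mul,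
    Matrix.mul_sub, hFF, Matrix.one_mul, Matrix.mul_one, sub_self, smul_zero, add_zero]
  have h : s • (F + star s • (1 - F) - F) = (star s * s) • (1 - F) := by module
  rw [h, hs]
  simp

/-- An `A`-direct sum of three unitaries, each of which is, up to a unitary on the `B` side,
controlled from the `B` side with two terms. -/
theorem implementableByLOCC_three_blocks {dA dB : ℕ}
    {U : Matrix (Fin dA × Fin dB) (Fin dA × Fin dB) ℂ} {T : Fin dA → Matrix (Fin dB) (Fin dB) ℂ}
    (hU : LocallyEquivalent U (controlled T)) {κ : Fin dA → Fin 3}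
    {G F : Fin 3 → Matrix (Fin dB) (Fin dB) ℂ} (hG : ∀ k, G k ∈ unitaryGroup (Fin dB) ℂ)
    (hF : ∀ k, (F k)ᴴ = F k) (hFF : ∀ k, F k * F k = F k) {x y : Fin dA → ℂ}
    (hx : ∀ j, star (x j) * x j = 1) (hy : ∀ j, star (y j) * y j = 1)
    (hT : ∀ j, T j = G (κ j) * (x j • F (κ j) + y j • (1 - F (κ j)))) :
    ImplementableByLOCC U (Real.logb 2 (6 : ℕ)) (2 * Real.logb 2 (6 : ℕ)) := by
  let s : Bool → ℂ := fun h => if h then -1 else 1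
  have hs : ∀ h, star (s h) * s h = 1 := fun h => by cases h <;> simp [s]
  have hR := fun k h => projection_add_smul_mem_unitaryGroup (hF k) (hFF k) (hs h)
  have := implementableByLOCC_of_blocks (K := Fin 3) (H := Bool) hU (κ := κ)
    (M := fun g h j => (x j + s g * s h * y j) / 2)
    (R := fun k h => F k + s h • (1 - F k))
    (Q := fun k g => (F k + s g • (1 - F k)) * (G k)ᴴ) hR
    (fun k g => mul_mem (hR k g) (Unitary.star_mem (hG k))) (fun j h h' => ?_) (fun j g => ?_)
  · simpa using this
  · have h1 := hx j
    have h2 := hy j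
    cases h <;> cases h' <;> simp [s] at h1 h2 ⊢ <;> 
      first | linear_combination (h1 + h2) / 2 | linear_combination (h1 - h2) / 2
  · have hG1 : (G (κ j))ᴴ * G (κ j) = 1 := mem_unitaryGroup_iff'.1 (hG _)
    rw [hT, Matrix.mul_assoc, ← Matrix.mul_assoc (G (κ j))ᴴ, hG1, Matrix.one_mul]
    simp only [Fintype.sum_bool, Matrix.add_mul, Matrix.mul_add, Matrix.smul_mul, Matrix.mul_smul,
      Matrix.sub_mul, Matrix.mul_sub, hFF, Matrix.one_mul, Matrix.mul_one, sub_self, smul_zero,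
      add_zero]
    cases g <;> simp only [s] <;> simp <;> module

theorem sum_smul_sum_smul {H R : Type*} [Fintype H] [AddCommGroup R] [Module ℂ R]
    (X Y : Matrix H H ℂ) (r : H → R) (g : H) :
    ∑ h, X g h • ∑ l, Y h l • r l = ∑ l, (X * Y) g l • r l := by
  simp only [Finset.smul_sum, smul_smul, mul_apply, Finset.sum_smul]
  exact Finset.sum_comm

section paired

variable {d : ℕ} {σ : Equiv.Perm (Fin d)}

/-- The power of an involution with exponent in `Bool`. -/
def boolPow (σ : Equiv.Perm (Fin d)) (a : Bool) : Equiv.Perm (Fin d) :=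
  if a then σ else Equiv.refl _

/-- The action of `T` on pairs `(a, i)`: the flag `a` is flipped when `T` moves `i` to its partner.
-/
def pairedAction (T : Matrix (Fin d) (Fin d) ℂ) : Matrix (Bool × Fin d) (Bool × Fin d) ℂ :=
  Matrix.of fun g h => if g.1 = xor h.1 (decide (g.2 ≠ h.2)) then T g.2 h.2 else 0

theorem sum_pairedAction_smul (hσ : ∀ i, σ (σ i) = i) {T : Matrix (Fin d) (Fin d) ℂ}
    (hT : ∀ i k, k ≠ i → k ≠ σ i → T k i = 0) (g : Bool × Fin d) :
    ∑ h, pairedAction T g h • Matrix.single (boolPow σ h.1 h.2) h.2 (1 : ℂ) =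
      Matrix.single (boolPow σ g.1 g.2) g.2 (1 : ℂ) * T := by
  obtain ⟨a', i'⟩ := g
  ext x y
  simp only [Fintype.sum_prod_type, Matrix.sum_apply, Matrix.smul_apply, pairedAction, of_apply,
    smul_eq_mul]
  have h1 : ∀ a : Bool, (∑ i, (if a' = xor a (decide (i' ≠ i)) then T i' i else 0) *
      Matrix.single (boolPow σ a i) i (1 : ℂ) x y) =
      (if a' = xor a (decide (i' ≠ y)) then T i' y else 0) *
        if boolPow σ a y = x then 1 else 0 := fun a => by
    rw [Finset.sum_eq_single y (fun c _ hc => by simp [hc]) (by simp)]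
    simp [single_apply]
  simp only [h1, Fintype.sum_bool]
  have h2 : (Matrix.single (boolPow σ a' i') i' (1 : ℂ) * T) x y =
      if boolPow σ a' i' = x then T i' y else 0 := by
    by_cases h : boolPow σ a' i' = x
    · subst h; simp
    · simp [h, Matrix.single_mul_apply_of_ne, Ne.symm h]
  rw [h2]
  by_cases h3 : i' = y
  · subst h3
    cases a' <;> simp
  · by_cases h4 : i' = σ y
    · have h5 : σ i' = y := by rw [h4, hσ]
      cases a' <;> simp [h3, boolPow, h5, ← h4]
    · simp [hT y i' h3 h4]

theorem pairedAction_mem_unitaryGroup {T : Matrix (Fin d) (Fin d) ℂ}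
    (hT : ∀ i k, k ≠ i → k ≠ σ i → T k i = 0) (hTU : T ∈ unitaryGroup (Fin d) ℂ) :
    pairedAction T ∈ unitaryGroup (Bool × Fin d) ℂ := by
  rw [mem_unitaryGroup_iff', star_eq_conjTranspose]
  ext ⟨a, i⟩ ⟨b, k⟩
  rw [conjTranspose_mul_apply, Fintype.sum_prod_type, Finset.sum_comm]
  simp only [pairedAction, of_apply]
  -- Two different columns can only overlap if they belong to the same pair, and then the flags in
  -- both rows of the pair agree under the same condition.
  have h1 : ∀ y, (∑ c : Bool, star (if c = xor a (decide (y ≠ i)) then T y i else 0) *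
      (if c = xor b (decide (y ≠ k)) then T y k else 0)) =
      if xor a b = decide (i ≠ k) then star (T y i) * T y k else 0 := by
    intro y
    have h2 : (∑ c : Bool, star (if c = xor a (decide (y ≠ i)) then T y i else 0) *
      (if c = xor b (decide (y ≠ k)) then T y k else 0)) =
      if xor a (decide (y ≠ i)) = xor b (decide (y ≠ k)) then star (T y i) * T y k else 0 := by
      rw [Finset.sum_eq_single (xor a (decide (y ≠ i))) (fun c _ hc => by rw [if_neg hc, star_zero, zero_mul]) (by simp)]
      rw [if_pos rfl]
      split_ifs <;> simp
    rw [h2]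
    by_cases h3 : T y i = 0
    · simp [h3]
    by_cases h4 : T y k = 0
    · simp [h4]
    have h5 : y = i ∨ y = σ i := by
      by_contra! h
      exact h3 (hT i y h.1 h.2)
    have h6 : y = k ∨ y = σ k := by
      by_contra! h
      exact h4 (hT k y h.1 h.2)
    have h7 : xor (decide (y ≠ i)) (decide (y ≠ k)) = decide (i ≠ k) := by
      by_cases h8 : y = i
      · subst h8
        simp
      · by_cases h9 : y = k
        · subst h9
          simp [h8, Ne.symm h8]
        · have : i = k := σ.injective (by
            rw [← h5.resolve_left h8, ← h6.resolve_left h9])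
          simp [this]
    have h8 : (xor a (decide (y ≠ i)) = xor b (decide (y ≠ k))) ↔
        (xor a b = xor (decide (y ≠ i)) (decide (y ≠ k))) := by
      cases a <;> cases b <;> cases decide (y ≠ i) <;> cases decide (y ≠ k) <;> simp
    rw [← h7]
    simp only [h8]
  simp only [h1]
  by_cases hik : i = k
  · subst hik
    by_cases hab : a = b
    · subst hab
      simp only [ne_eq, not_true_eq_false, decide_false, Bool.xor_self, if_true,
        conjTranspose_mul_apply_self hTU]
      simp
    · have : xor a b = true := by cases a <;> cases b <;> simp_all
      simp [this, one_apply, hab]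
  · by_cases hab : xor a b = true
    · simp only [ne_eq, hik, not_false_eq_true, decide_true, hab, if_true,
        conjTranspose_mul_apply_self hTU]
      simp [one_apply, hik]
    · simp [hik, hab, one_apply]

/-- If all the `T j` are block diagonal with respect to the same pairing of the basis vectors, then
they act on the family of unitaries `|i⟩ ↦ χ k i |σ ^ a i⟩`, where `χ` is a complex Hadamard matrix;
this is the dihedral group when `χ` consists of characters. -/
theorem implementableByLOCC_paired {dA : ℕ} (hd : 0 < d)
    {U : Matrix (Fin dA × Fin d) (Fin dA × Fin d) ℂ} {T : Fin dA → Matrix (Fin d) (Fin d) ℂ}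
    (hU : LocallyEquivalent U (controlled T)) (hTU : ∀ j, T j ∈ unitaryGroup (Fin d) ℂ)
    (hσ : ∀ i, σ (σ i) = i) (hT : ∀ j i k, k ≠ i → k ≠ σ i → T j k i = 0) :
    ImplementableByLOCC U (Real.logb 2 ((2 * d : ℕ) : ℝ))
      (2 * Real.logb 2 ((2 * d : ℕ) : ℝ)) := by
  have : NeZero d := ⟨hd.ne'⟩
  have hd0 : (d : ℂ) ≠ 0 := Nat.cast_ne_zero.2 hd.ne'
  obtain ⟨χ, hχ1, hχ⟩ := exists_complexHadamard (Fin d)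
  let r : Bool × Fin d → Matrix (Fin d) (Fin d) ℂ :=
    fun h => Matrix.single (boolPow σ h.1 h.2) h.2 1
  let Φ : Matrix (Bool × Fin d) (Bool × Fin d) ℂ := Matrix.of fun g h =>
    if g.1 = h.1 then ((1 / Real.sqrt d : ℝ) : ℂ) * χ g.2 h.2 else 0
  have hΦ : Φᴴ * Φ = 1 := by
    ext ⟨a, i⟩ ⟨b, k⟩
    rw [conjTranspose_mul_apply, Fintype.sum_prod_type]
    simp only [Φ, of_apply]
    rw [Finset.sum_eq_single a (fun c _ hc => by simp [hc]) (by simp)]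
    by_cases hab : a = b
    · subst hab
      have h1 : ∀ x, star (((1 / Real.sqrt d : ℝ) : ℂ) * χ x i) *
          (((1 / Real.sqrt d : ℝ) : ℂ) * χ x k) = (d : ℂ)⁻¹ * (star (χ x i) * χ x k) := by
        intro x
        rw [← inv_sqrt_mul_self, star_mul', RCLike.star_def, Complex.conj_ofReal]
        ring
      simp only [if_true, h1, ← Finset.mul_sum, hχ]
      by_cases hik : i = k <;> simp [hik, hd0, one_apply]
    · simp [hab, one_apply]
  have hΦ' : Φ ∈ unitaryGroup (Bool × Fin d) ℂ := mem_unitaryGroup_iff'.2 hΦ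
  have hsqrt : ((1 / Real.sqrt d : ℝ) : ℂ) ≠ 0 := by
    have : Real.sqrt d ≠ 0 := (Real.sqrt_pos.2 (Nat.cast_pos.2 hd)).ne'
    exact_mod_cast one_div_ne_zero this
  have hR : ∀ g : Bool × Fin d,
      (((1 / Real.sqrt d : ℝ) : ℂ)⁻¹ • ∑ h, Φ g h • r h) ∈ unitaryGroup (Fin d) ℂ := by
    rintro ⟨a, k⟩
    have h1 : (((1 / Real.sqrt d : ℝ) : ℂ)⁻¹ • ∑ h, Φ (a, k) h • r h) =
        Matrix.of fun x i => if x = boolPow σ a i then χ k i else 0 := by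
      ext x i
      simp only [Matrix.smul_apply, Matrix.sum_apply, Fintype.sum_prod_type, Φ, r, of_apply,
        smul_eq_mul]
      rw [Finset.sum_eq_single a (fun c _ hc => by simp [Ne.symm hc]) (by simp),
        Finset.sum_eq_single i (fun c _ hc => by simp [hc]) (by simp)]
      by_cases hx : x = boolPow σ a i
      · subst hx
        rw [if_pos rfl, if_pos rfl, single_apply_same, mul_one, inv_mul_cancel_left₀ hsqrt]
      · simp [hx, Ne.symm hx]
    rw [h1, mem_unitaryGroup_iff', star_eq_conjTranspose]
    ext i l
    rw [conjTranspose_mul_apply]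
    simp only [of_apply]
    rw [Finset.sum_eq_single (boolPow σ a i) (fun c _ hc => by simp [hc]) (by simp)]
    by_cases hil : i = l
    · subst hil
      simp only [if_true, hχ1, one_apply]
    · simp [hil, one_apply]
  have := implementableByLOCC_of_blocks (K := Unit) (H := Bool × Fin d) hU (κ := fun _ => ())
    (M := fun g h j => (Φ * pairedAction (T j) * Φᴴ) g h)
    (R := fun _ h => ((1 / Real.sqrt d : ℝ) : ℂ)⁻¹ • ∑ l, Φ h l • r l)
    (Q := fun _ h => ((1 / Real.sqrt d : ℝ) : ℂ)⁻¹ • ∑ l, Φ h l • r l) (fun _ => hR) (fun _ => hR)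
    (fun j h h' => conjTranspose_mul_apply_self (mul_mem (mul_mem hΦ'
      (pairedAction_mem_unitaryGroup (hT j) (hTU j))) (Unitary.star_mem hΦ')) h h')
    (fun j g => ?_)
  · simpa using this
  · simp only [smul_comm _ (((1 / Real.sqrt d : ℝ) : ℂ)⁻¹)]
    rw [← Finset.smul_sum, sum_smul_sum_smul, Matrix.mul_assoc, hΦ, Matrix.mul_one,
      ← sum_smul_sum_smul]
    have h1 : ∀ g, ∑ l, pairedAction (T j) g l • r l = r g * T j :=
      sum_pairedAction_smul hσ (hT j)
    simp only [h1, Matrix.smul_mul, Matrix.sum_mul]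

end paired

/-! ### Direct sums -/

section directSum

variable {dA dB : ℕ}

/-- The terms of a controlled unitary can be sorted arbitrarily into blocks. -/
theorem isADirectSum_controlled {n : ℕ} {T : Fin dA → Matrix (Fin dB) (Fin dB) ℂ}
    (hT : ∀ j, T j ∈ unitaryGroup (Fin dB) ℂ) (κ : Fin dA → Fin n) :
    IsADirectSum (controlled T) (fun k => diagonal fun j => if κ j = k then 1 else 0)
      (fun k => controlled fun j => if κ j = k then T j else 0) := by
  refine ⟨⟨fun k => ?_, fun k l => ?_, ?_⟩, fun k => ?_, fun k => ?_, ?_⟩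
  · rw [IsHermitian, diagonal_conjTranspose]
    congr 1
    funext j
    by_cases h : κ j = k <;> simp [h]
  · rw [diagonal_mul_diagonal]
    by_cases hkl : k = l
    · subst hkl
      simp
    · rw [if_neg hkl, ← diagonal_zero]
      congr 1
      funext j
      by_cases h : κ j = k
      · simp [h, hkl]
      · simp [h]
  · ext i j
    by_cases h : i = j
    · subst h
      simp [Matrix.sum_apply]
    · simp [Matrix.sum_apply, h]
  · rw [controlled_conjTranspose, controlled_mul, diagonal_kronecker_eq_controlled]
    congr 1
    funext j
    have : (T j)ᴴ * T j = 1 := mem_unitaryGroup_iff'.1 (hT j)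
    by_cases h : κ j = k <;> simp [h, this]
  · rw [controlled_conjTranspose, controlled_mul, diagonal_kronecker_eq_controlled]
    congr 1
    funext j
    have : T j * (T j)ᴴ = 1 := mem_unitaryGroup_iff.1 (hT j)
    by_cases h : κ j = k <;> simp [h, this]
  · rw [controlled_sum]
    congr 1
    funext j
    simp

theorem schmidtRankLE_controlled {r : ℕ} {T : Fin dA → Matrix (Fin dB) (Fin dB) ℂ}
    (Y : Fin r → Matrix (Fin dB) (Fin dB) ℂ) (z : Fin dA → Fin r → ℂ)
    (h : ∀ j, T j = ∑ i, z j i • Y i) : SchmidtRankLE (controlled T) r := by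
  refine schmidtRankLE_of_eq_sum (fun i => diagonal fun j => z j i) Y ?_
  simp only [diagonal_kronecker_eq_controlled]
  rw [controlled_sum]
  congr 1
  funext j
  exact h j

/-- The projection onto the span of the basis vectors `i` and `σ i`. -/
def pairProjection (σ : Equiv.Perm (Fin dB)) (i : Fin dB) : Matrix (Fin dB) (Fin dB) ℂ :=
  diagonal fun k => if k = i ∨ k = σ i then 1 else 0

theorem pairProjection_conjTranspose (σ : Equiv.Perm (Fin dB)) (i : Fin dB) :
    (pairProjection σ i)ᴴ = pairProjection σ i := by
  rw [pairProjection, diagonal_conjTranspose]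
  congr 1
  funext k
  by_cases h : k = i ∨ k = σ i <;> simp [h]

theorem pairProjection_mul_self (σ : Equiv.Perm (Fin dB)) (i : Fin dB) :
    pairProjection σ i * pairProjection σ i = pairProjection σ i := by
  rw [pairProjection, diagonal_mul_diagonal]
  congr 1
  funext k
  by_cases h : k = i ∨ k = σ i <;> simp [h]

theorem rank_pairProjection (σ : Equiv.Perm (Fin dB)) (i : Fin dB) :
    (pairProjection σ i).rank = 1 ∨ (pairProjection σ i).rank = 2 := by
  have h : Fintype.card {k // (if k = i ∨ k = σ i then (1 : ℂ) else 0) ≠ 0} =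
      ({i, σ i} : Finset (Fin dB)).card := by
    rw [Fintype.card_subtype]
    congr 1
    ext k
    simp [or_iff_not_imp_left]
  rw [pairProjection, Matrix.rank_diagonal, h]
  by_cases hi : i = σ i
  · left
    rw [← hi]
    simp
  · right
    exact Finset.card_pair hi

theorem pairProjection_commute {σ : Equiv.Perm (Fin dB)} (hσ : ∀ i, σ (σ i) = i)
    {T : Matrix (Fin dB) (Fin dB) ℂ} (hT : ∀ i k, k ≠ i → k ≠ σ i → T k i = 0) (i : Fin dB) :
    pairProjection σ i * T = T * pairProjection σ i := by
  ext k l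
  rw [pairProjection, diagonal_mul, mul_diagonal]
  by_cases h : T k l = 0
  · simp [h]
  · have hkl : k = l ∨ k = σ l := by
      by_contra! h'
      exact h (hT l k h'.1 h'.2)
    have : (k = i ∨ k = σ i) ↔ (l = i ∨ l = σ i) := by
      rcases hkl with rfl | rfl
      · rfl
      · constructor
        · rintro (h1 | h1)
          · exact Or.inr (by rw [← h1, hσ])
          · exact Or.inl (σ.injective h1)
        · rintro (h1 | h1)
          · exact Or.inr (by rw [h1])
          · exact Or.inl (by rw [h1, hσ])
    simp only [this]
    ring

/-- If the `T j` are block diagonal with respect to a pairing of the basis vectors, then the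
controlled unitary is the `B`-direct sum of its restrictions to the pairs. -/
theorem exists_isBDirectSum_controlled {r : ℕ} {T : Fin dA → Matrix (Fin dB) (Fin dB) ℂ}
    (hTU : ∀ j, T j ∈ unitaryGroup (Fin dB) ℂ) {σ : Equiv.Perm (Fin dB)}
    (hσ : ∀ i, σ (σ i) = i) (hT : ∀ j i k, k ≠ i → k ≠ σ i → T j k i = 0)
    (Y : Fin r → Matrix (Fin dB) (Fin dB) ℂ) (z : Fin dA → Fin r → ℂ)
    (h : ∀ j, T j = ∑ i, z j i • Y i) :
    ∃ (n : ℕ) (F : Fin n → Matrix (Fin dB) (Fin dB) ℂ)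
      (W : Fin n → Matrix (Fin dA × Fin dB) (Fin dA × Fin dB) ℂ),
      IsBDirectSum (controlled T) F W ∧
      ∀ k, ((F k).rank = 1 ∨ (F k).rank = 2) ∧ IsControlledInBasisA (W k) ∧
        SchmidtRankLE (W k) r := by
  -- Each pair `{i, σ i}` is represented by its smaller element.
  obtain ⟨e⟩ : Nonempty (Fin (Fintype.card {i : Fin dB // i ≤ σ i}) ≃ {i : Fin dB // i ≤ σ i}) :=
    ⟨(Fintype.equivFin _).symm⟩
  have hF : ∑ k, pairProjection σ (e k : Fin dB) = 1 := by
    rw [e.sum_comp (fun i => pairProjection σ (i : Fin dB))]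
    ext x y
    simp only [Matrix.sum_apply, pairProjection]
    by_cases hxy : x = y
    · subst hxy
      simp only [diagonal_apply_eq, one_apply_eq]
      have hmin : min x (σ x) ≤ σ (min x (σ x)) := by
        rcases le_total x (σ x) with h | h
        · rwa [min_eq_left h]
        · rwa [min_eq_right h, hσ]
      rw [Finset.sum_eq_single ⟨min x (σ x), hmin⟩ (fun c _ hc => ?_) (by simp)]
      · rw [if_pos]
        rcases le_total x (σ x) with h | h
        · exact Or.inl (min_eq_left h).symm
        · exact Or.inr (by simp only [min_eq_right h, hσ])
      · rw [if_neg]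
        rintro (h | h)
        · exact hc (Subtype.ext (by simp only [h, min_eq_left c.2]))
        · exact hc (Subtype.ext (by simp only [h, hσ, min_eq_right c.2]))
    · simp [hxy]
  refine ⟨_, fun k => pairProjection σ (e k), fun k => controlled fun j =>
    T j * pairProjection σ (e k), ⟨⟨fun k => pairProjection_conjTranspose σ _, fun k l => ?_, hF⟩,
      fun k => ?_, fun k => ?_, ?_⟩, fun k => ⟨rank_pairProjection σ _, ⟨_, rfl⟩, ?_⟩⟩
  · by_cases hkl : k = l
    · subst hkl
      rw [if_pos rfl, pairProjection_mul_self]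
    · rw [if_neg hkl, pairProjection, pairProjection, diagonal_mul_diagonal, ← diagonal_zero]
      congr 1
      funext x
      by_contra hx
      have h1 : x = (e k : Fin dB) ∨ x = σ (e k) := by
        by_contra h
        exact hx (by rw [if_neg h, zero_mul])
      have h2 : x = (e l : Fin dB) ∨ x = σ (e l) := by
        by_contra h
        exact hx (by rw [if_neg h, mul_zero])
      have h3 : ∀ k, (x = (e k : Fin dB) ∨ x = σ (e k)) → (e k : Fin dB) = min x (σ x) := by
        rintro k (h | h)
        · rw [h, min_eq_left (e k).2]
        · rw [h, hσ, min_eq_right (e k).2]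
      exact hkl (e.injective (Subtype.ext ((h3 k h1).trans (h3 l h2).symm)))
  · rw [controlled_conjTranspose, controlled_mul, one_kronecker_eq_controlled]
    congr 1
    funext j
    have : (T j)ᴴ * T j = 1 := mem_unitaryGroup_iff'.1 (hTU j)
    rw [conjTranspose_mul, Matrix.mul_assoc, ← Matrix.mul_assoc (T j)ᴴ, this, Matrix.one_mul,
      pairProjection_conjTranspose, pairProjection_mul_self]
  · rw [controlled_conjTranspose, controlled_mul, one_kronecker_eq_controlled]
    congr 1
    funext j
    have : T j * (T j)ᴴ = 1 := mem_unitaryGroup_iff.1 (hTU j)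
    rw [← pairProjection_commute hσ (hT j), conjTranspose_mul, Matrix.mul_assoc,
      ← Matrix.mul_assoc (T j), this, Matrix.one_mul,
      pairProjection_conjTranspose, pairProjection_mul_self]
  · rw [controlled_sum]
    congr 1
    funext j
    rw [← Matrix.mul_sum, hF, Matrix.mul_one]
  · refine schmidtRankLE_controlled (fun i => Y i * pairProjection σ (e k)) z fun j => ?_
    rw [h j, Matrix.sum_mul]
    simp only [Matrix.smul_mul]

end directSum

/-! ### The terms of a controlled unitary of Schmidt rank three -/

section terms

variable {dA dB : ℕ}

/-- The terms of a controlled unitary of Schmidt rank `r` are spanned by `r` of them. The chosen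
terms may repeat, so independence is not claimed. -/
theorem exists_spanning_terms {U : Matrix (Fin dA × Fin dB) (Fin dA × Fin dB) ℂ}
    {T : Fin dA → Matrix (Fin dB) (Fin dB) ℂ} {r : ℕ} (hr : HasSchmidtRank U r) [NeZero dA]
    (hUT : LocallyEquivalent U (controlled T)) :
    ∃ (X : Fin r → Fin dA) (z : Fin dA → Fin r → ℂ), ∀ j, T j = ∑ i, z j i • T (X i) := by
  obtain ⟨S, R, -, -, hU⟩ := hr
  obtain ⟨Pa, Ra, Qb, Sb, hPa, hRa, hQb, hSb, hUT⟩ := hUT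
  have hT : controlled T = ∑ i, (Paᴴ * S i * Raᴴ) ⊗ₖ (Qbᴴ * R i * Sbᴴ) := by
    have h1 : Paᴴ * Pa = 1 := mem_unitaryGroup_iff'.1 hPa
    have h2 : Qbᴴ * Qb = 1 := mem_unitaryGroup_iff'.1 hQb
    have h3 : Ra * Raᴴ = 1 := mem_unitaryGroup_iff.1 hRa
    have h4 : Sb * Sbᴴ = 1 := mem_unitaryGroup_iff.1 hSb
    have h5 : controlled T = (Paᴴ ⊗ₖ Qbᴴ) * U * (Raᴴ ⊗ₖ Sbᴴ) := by
      rw [hUT]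
      have : (Paᴴ ⊗ₖ Qbᴴ) * ((Pa ⊗ₖ Qb) * controlled T * (Ra ⊗ₖ Sb)) * (Raᴴ ⊗ₖ Sbᴴ) =
          ((Paᴴ ⊗ₖ Qbᴴ) * (Pa ⊗ₖ Qb)) * controlled T * ((Ra ⊗ₖ Sb) * (Raᴴ ⊗ₖ Sbᴴ)) := by
        simp only [Matrix.mul_assoc]
      rw [this, ← mul_kronecker_mul, ← mul_kronecker_mul, h1, h2, h3, h4, one_kronecker_one,
        Matrix.one_mul, Matrix.mul_one]
    rw [h5, hU, Matrix.mul_sum, Matrix.sum_mul]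
    simp only [← mul_kronecker_mul]
  set R' := fun i => Qbᴴ * R i * Sbᴴ with hR'
  have hspan : ∀ j, T j ∈ Submodule.span ℂ (Set.range R') := fun j => by
    have : T j = ∑ i, (Paᴴ * S i * Raᴴ) j j • R' i := by
      ext y y'
      have := congrFun (congrFun hT (j, y)) (j, y')
      rw [controlled_apply, if_pos rfl] at this
      rw [this]
      simp [Matrix.sum_apply, hR']
    rw [this]
    exact Submodule.sum_mem _ fun i _ => Submodule.smul_mem _ _ (Submodule.subset_span ⟨i, rfl⟩)
  have hfin : Module.finrank ℂ (Submodule.span ℂ (Set.range T)) ≤ r := by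
    have h1 : Submodule.span ℂ (Set.range T) ≤ Submodule.span ℂ (Set.range R') := by
      rw [Submodule.span_le]
      rintro _ ⟨j, rfl⟩
      exact hspan j
    refine (Submodule.finrank_mono h1).trans ?_
    exact (finrank_range_le_card (R := ℂ) R').trans_eq (Fintype.card_fin r)
  obtain ⟨f, hf, hfspan, -⟩ := Submodule.exists_fun_fin_finrank_span_eq ℂ (Set.range T)
  choose x hx using hf
  let X : Fin r → Fin dA := fun i =>
    if hi : (i : ℕ) < Module.finrank ℂ (Submodule.span ℂ (Set.range T)) then x ⟨i, hi⟩ else 0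
  have hX : ∀ j, T j ∈ Submodule.span ℂ (Set.range fun i => T (X i)) := fun j => by
    have h1 : T j ∈ Submodule.span ℂ (Set.range f) := by
      rw [hfspan]; exact Submodule.subset_span ⟨j, rfl⟩
    refine Submodule.span_mono ?_ h1
    rintro _ ⟨i, rfl⟩
    refine ⟨⟨i, i.2.trans_le hfin⟩, ?_⟩
    simp only [X]
    rw [dif_pos i.2, hx]
  simp only [Submodule.mem_span_range_iff_exists_fun] at hX
  choose z hz using hX
  exact ⟨X, z, fun j => (hz j).symm⟩

/-- `T` is a combination, with coefficients of modulus one, of `G F` and `G (1 - F)`. -/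
def IsCoveredBy (T G F : Matrix (Fin dB) (Fin dB) ℂ) : Prop :=
  ∃ x y : ℂ, star x * x = 1 ∧ star y * y = 1 ∧ T = G * (x • F + y • (1 - F))

/-- Let each of the unitaries `T j` be a combination of at most two of the unitaries `X 0`, `X 1`,
`X 2`. The block `l` takes care of all proper combinations of the two `X i` with `i ≠ l` if there
are any; otherwise it takes care of the multiples of `X (l + 1)`. In both cases it covers the
multiples of `X (l + 1)`, so nothing is left over. -/
theorem exists_three_covering_blocks {T : Fin dA → Matrix (Fin dB) (Fin dB) ℂ}
    (hT : ∀ j, T j ∈ unitaryGroup (Fin dB) ℂ) {X : Fin 3 → Matrix (Fin dB) (Fin dB) ℂ}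
    (hX : ∀ i, X i ∈ unitaryGroup (Fin dB) ℂ) {z : Fin dA → Fin 3 → ℂ}
    (hz : ∀ j, T j = ∑ i, z j i • X i) (hz0 : ∀ j, ∃ i, z j i = 0) :
    ∃ G F : Fin 3 → Matrix (Fin dB) (Fin dB) ℂ, (∀ k, G k ∈ unitaryGroup (Fin dB) ℂ) ∧
      (∀ k, (F k)ᴴ = F k) ∧ (∀ k, F k * F k = F k) ∧
      ∀ j, ∃ k, IsCoveredBy (T j) (G k) (F k) := by
  have hsum : ∀ (l : Fin 3) j, T j = z j l • X l + z j (l + 1) • X (l + 1) +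
      z j (l + 2) • X (l + 2) := by
    intro l j
    rw [hz, Fin.sum_univ_three]
    fin_cases l <;> simp <;> abel
  have hcov : ∀ (G F : Matrix (Fin dB) (Fin dB) ℂ) (x y : ℂ) j, G ∈ unitaryGroup (Fin dB) ℂ →
      Fᴴ = F → F * F = F → T j = G * (x • F + y • (1 - F)) → IsCoveredBy (T j) G F := by
    intro G F x y j hG hF hFF h
    obtain ⟨x', y', hx', hy', hxy⟩ :=
      exists_unimodular_of_mem_unitaryGroup (x := x) (y := y) hG hF hFF (by rw [← h]; exact hT j)
    exact ⟨x', y', hx', hy', h.trans hxy⟩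
  have hblock : ∀ l : Fin 3, ∃ G F : Matrix (Fin dB) (Fin dB) ℂ,
      G ∈ unitaryGroup (Fin dB) ℂ ∧ Fᴴ = F ∧ F * F = F ∧
      (∀ j, z j l = 0 → z j (l + 1) ≠ 0 → z j (l + 2) ≠ 0 → IsCoveredBy (T j) G F) ∧
      ∀ j, z j l = 0 → z j (l + 2) = 0 → IsCoveredBy (T j) G F := by
    intro l
    by_cases h : ∃ j, z j l = 0 ∧ z j (l + 1) ≠ 0 ∧ z j (l + 2) ≠ 0
    · obtain ⟨j, h0, h1, h2⟩ := h
      have hj := hsum l j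
      rw [h0, zero_smul, zero_add] at hj
      obtain ⟨F, x, y, hF, hFF, hY⟩ := exists_projection_of_smul_add_smul_mem_unitaryGroup
        (hX (l + 1)) (hX (l + 2)) h1 h2 (by rw [← hj]; exact hT j)
      have hpair : ∀ j, z j l = 0 → IsCoveredBy (T j) (X (l + 1)) F := fun j h0 => by
        refine hcov _ F (z j (l + 1) + z j (l + 2) * x) (z j (l + 1) + z j (l + 2) * y) j (hX _)
          hF hFF ?_
        rw [hsum l j, h0, zero_smul, zero_add, hY]
        have h3 : X (l + 1) = X (l + 1) * 1 := (Matrix.mul_one _).symm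
        conv_lhs => arg 1; rw [h3]
        rw [← Matrix.mul_smul, ← Matrix.mul_smul, ← Matrix.mul_add]
        congr 1
        module
      exact ⟨X (l + 1), F, hX _, hF, hFF, fun j h0 _ _ => hpair j h0, fun j h0 _ => hpair j h0⟩
    · refine ⟨X (l + 1), 1, hX _, by simp, by simp, fun j h0 h1 h2 => (h ⟨j, h0, h1, h2⟩).elim,
        fun j h0 h2 => hcov _ 1 (z j (l + 1)) 0 j (hX _) (by simp) (by simp) ?_⟩
      rw [hsum l j, h0, h2]
      simp
  choose G F hG hF hFF hprop haxis using hblock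
  refine ⟨G, F, hG, hF, hFF, fun j => ?_⟩
  obtain ⟨i, hi⟩ := hz0 j
  by_cases h1 : z j (i + 1) = 0
  · have e1 : i + 1 + 2 = i := by fin_cases i <;> rfl
    exact ⟨i + 1, haxis (i + 1) j h1 (by rw [e1]; exact hi)⟩
  · by_cases h2 : z j (i + 2) = 0
    · exact ⟨i, haxis i j hi h2⟩
    · exact ⟨i, hprop i j hi h1 h2⟩

end terms

/-! ### Reduction to paired terms and choice of the protocol -/

theorem ImplementableByLOCC.mono {dA dB : ℕ} {U : Matrix (Fin dA × Fin dB) (Fin dA × Fin dB) ℂ}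
    {N e c : ℕ} (hN : 0 < N) (hNe : N ≤ e) (hNc : N ≤ c)
    (h : ImplementableByLOCC U (Real.logb 2 N) (2 * Real.logb 2 N)) :
    ImplementableByLOCC U (Real.logb 2 e) (2 * Real.logb 2 c) := by
  have hlog : ∀ {m : ℕ}, N ≤ m → Real.logb 2 N ≤ Real.logb 2 m := fun h =>
    Real.logb_le_logb_of_le one_lt_two (by exact_mod_cast hN) (by exact_mod_cast h)
  obtain ⟨n, p, hn, he, hc, hp⟩ := h
  exact ⟨n, p, hn, he.trans (hlog hNe), hc.trans (by linarith [hlog hNc]), hp⟩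

theorem le_of_hasSchmidtRank {dA dB r : ℕ} {U : Matrix (Fin dA × Fin dB) (Fin dA × Fin dB) ℂ}
    (h : HasSchmidtRank U r) : r ≤ dA * dA ∧ r ≤ dB * dB := by
  obtain ⟨S, T, hS, hT, -⟩ := h
  have h1 := hS.fintype_card_le_finrank
  have h2 := hT.fintype_card_le_finrank
  simp only [Fintype.card_fin, Module.finrank_matrix, Module.finrank_self, mul_one] at h1 h2
  exact ⟨h1, h2⟩

theorem LocallyEquivalent.mul_right_controlled {dA dB : ℕ}
    {U : Matrix (Fin dA × Fin dB) (Fin dA × Fin dB) ℂ} {T : Fin dA → Matrix (Fin dB) (Fin dB) ℂ}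
    (h : LocallyEquivalent U (controlled T)) {G Q : Matrix (Fin dB) (Fin dB) ℂ}
    (hG : G ∈ unitaryGroup (Fin dB) ℂ) (hQ : Q ∈ unitaryGroup (Fin dB) ℂ) :
    LocallyEquivalent U (controlled fun j => Gᴴ * T j * Q) := by
  obtain ⟨Pa, Ra, Qb, Sb, hPa, hRa, hQb, hSb, rfl⟩ := h
  have h1 : G * Gᴴ = 1 := mem_unitaryGroup_iff.1 hG
  have h2 : Q * Qᴴ = 1 := mem_unitaryGroup_iff.1 hQ
  refine ⟨Pa, Ra, Qb * G, Qᴴ * Sb, hPa, hRa, mul_mem hQb hG,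
    mul_mem (Unitary.star_mem hQ) hSb, ?_⟩
  have h3 : controlled T = ((1 : Matrix (Fin dA) (Fin dA) ℂ) ⊗ₖ G) *
      controlled (fun j => Gᴴ * T j * Q) * ((1 : Matrix (Fin dA) (Fin dA) ℂ) ⊗ₖ Qᴴ) := by
    rw [one_kronecker_eq_controlled, one_kronecker_eq_controlled, controlled_mul, controlled_mul]
    congr 1
    funext j
    have : G * (Gᴴ * T j * Q) * Qᴴ = (G * Gᴴ) * T j * (Q * Qᴴ) := by
      simp only [Matrix.mul_assoc]
    rw [this, h1, h2, Matrix.one_mul, Matrix.mul_one]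
  have h4 : Pa ⊗ₖ (Qb * G) = (Pa ⊗ₖ Qb) * ((1 : Matrix (Fin dA) (Fin dA) ℂ) ⊗ₖ G) := by
    rw [← mul_kronecker_mul, Matrix.mul_one]
  have h5 : Ra ⊗ₖ (Qᴴ * Sb) = ((1 : Matrix (Fin dA) (Fin dA) ℂ) ⊗ₖ Qᴴ) * (Ra ⊗ₖ Sb) := by
    rw [← mul_kronecker_mul, Matrix.one_mul]
  rw [h3, h4, h5]
  simp only [Matrix.mul_assoc]

theorem LocallyEquivalent.mem_unitaryGroup {dA dB : ℕ}
    {U V : Matrix (Fin dA × Fin dB) (Fin dA × Fin dB) ℂ} (h : LocallyEquivalent U V)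
    (hU : U ∈ unitaryGroup (Fin dA × Fin dB) ℂ) : V ∈ unitaryGroup (Fin dA × Fin dB) ℂ := by
  obtain ⟨Pa, Ra, Qb, Sb, hPa, hRa, hQb, hSb, rfl⟩ := h
  have h1 := kronecker_mem_unitary hPa hQb
  have h2 := kronecker_mem_unitary hRa hSb
  have h3 : V = star (Pa ⊗ₖ Qb) * ((Pa ⊗ₖ Qb) * V * (Ra ⊗ₖ Sb)) * star (Ra ⊗ₖ Sb) := by
    have : star (Pa ⊗ₖ Qb) * ((Pa ⊗ₖ Qb) * V * (Ra ⊗ₖ Sb)) * star (Ra ⊗ₖ Sb) =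
        (star (Pa ⊗ₖ Qb) * (Pa ⊗ₖ Qb)) * V * ((Ra ⊗ₖ Sb) * star (Ra ⊗ₖ Sb)) := by
      simp only [Matrix.mul_assoc]
    rw [this, Unitary.star_mul_self_of_mem h1, Unitary.mul_star_self_of_mem h2, Matrix.one_mul,
      Matrix.mul_one]
  rw [h3]
  exact mul_mem (mul_mem (Unitary.star_mem h1) hU) (Unitary.star_mem h2)

/-- If some term is a combination of the unitaries `T (X 0)`, `T (X 1)`, `T (X 2)` with nonzero
coefficients, then all the terms become block diagonal for one pairing of the basis vectors, after
multiplication with fixed unitaries. -/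
theorem exists_paired_terms {dA dB : ℕ} {T : Fin dA → Matrix (Fin dB) (Fin dB) ℂ}
    (hT : ∀ j, T j ∈ unitaryGroup (Fin dB) ℂ) {X : Fin 3 → Fin dA} {z : Fin dA → Fin 3 → ℂ}
    (hz : ∀ j, T j = ∑ i, z j i • T (X i)) {j₀ : Fin dA} (hj₀ : ∀ i, z j₀ i ≠ 0) :
    ∃ G ∈ unitaryGroup (Fin dB) ℂ, ∃ Q ∈ unitaryGroup (Fin dB) ℂ, ∃ σ : Equiv.Perm (Fin dB),
      (∀ i, σ (σ i) = i) ∧ ∀ j i k, k ≠ i → k ≠ σ i → (Gᴴ * T j * Q) k i = 0 := by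
  have h0 : (T (X 0))ᴴ * T (X 0) = 1 := mem_unitaryGroup_iff'.1 (hT _)
  have hX0 : (T (X 0))ᴴ ∈ unitaryGroup (Fin dB) ℂ := Unitary.star_mem (hT _)
  have hsum : ∀ j, (T (X 0))ᴴ * T j = z j 0 • (1 : Matrix (Fin dB) (Fin dB) ℂ) +
      z j 1 • ((T (X 0))ᴴ * T (X 1)) + z j 2 • ((T (X 0))ᴴ * T (X 2)) := fun j => by
    conv_lhs => rw [hz j, Fin.sum_univ_three]
    simp only [Matrix.mul_add, Matrix.mul_smul, h0]
  obtain ⟨Q, hQ, σ, hσ, hQσ⟩ := exists_unitary_paired (mul_mem hX0 (hT (X 1)))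
    (mul_mem hX0 (hT (X 2))) (hj₀ 0) (hj₀ 1) (hj₀ 2)
    (by rw [← hsum]; exact mul_mem hX0 (hT _))
  refine ⟨T (X 0) * Q, mul_mem (hT _) hQ, Q, hQ, σ, hσ, fun j i k hki hkσ => ?_⟩
  have hQQ : Qᴴ * Q = 1 := mem_unitaryGroup_iff'.1 hQ
  obtain ⟨h1, h2⟩ := hQσ i k hki hkσ
  have h3 : (T (X 0) * Q)ᴴ * T j * Q = z j 0 • (1 : Matrix (Fin dB) (Fin dB) ℂ) +
      z j 1 • (Qᴴ * ((T (X 0))ᴴ * T (X 1)) * Q) + z j 2 • (Qᴴ * ((T (X 0))ᴴ * T (X 2)) * Q) := by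
    rw [conjTranspose_mul, Matrix.mul_assoc Qᴴ, hsum]
    simp only [Matrix.mul_add, Matrix.add_mul, Matrix.mul_smul, Matrix.smul_mul, Matrix.mul_one,
      hQQ]
  rw [h3]
  simp [h1, h2, one_apply, hki]

theorem theorem1 {dA dB : ℕ} (U C : Matrix (Fin dA × Fin dB) (Fin dA × Fin dB) ℂ)
    (hU : U ∈ unitaryGroup (Fin dA × Fin dB) ℂ)
    (hrank : HasSchmidtRank U 3)
    (hC : IsControlledInBasisA C)
    (hUC : LocallyEquivalent U C) :
    ((∃ (n : ℕ) (E : Fin n → Matrix (Fin dA) (Fin dA) ℂ)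
        (W : Fin n → Matrix (Fin dA × Fin dB) (Fin dA × Fin dB) ℂ),
        n ≤ 3 ∧ IsADirectSum C E W ∧ ∀ k, SchmidtRankLE (W k) 2) ∨
      (∃ (V : Matrix (Fin dA × Fin dB) (Fin dA × Fin dB) ℂ) (n : ℕ)
        (F : Fin n → Matrix (Fin dB) (Fin dB) ℂ)
        (W : Fin n → Matrix (Fin dA × Fin dB) (Fin dA × Fin dB) ℂ),
        LocallyEquivalent U V ∧ IsBDirectSum V F W ∧
        ∀ k, ((F k).rank = 1 ∨ (F k).rank = 2) ∧
          IsControlledInBasisA (W k) ∧ SchmidtRankLE (W k) 3)) ∧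
    ImplementableByLOCC U
      (Real.logb 2 ((min dA (min (dB ^ 2) (4 * (dB / 2) + 2)) : ℕ) : ℝ))
      (2 * Real.logb 2 ((min dA (min (dB ^ 2) (max 12 (4 * (dB / 2) + 2))) : ℕ) : ℝ)) := by
  obtain ⟨T, rfl⟩ := hC
  change LocallyEquivalent U (controlled T) at hUC
  have hT := mem_unitaryGroup_of_controlled (hUC.mem_unitaryGroup hU)
  obtain ⟨hdA, hdB⟩ := le_of_hasSchmidtRank hrank
  have hdA0 : 0 < dA := Nat.pos_of_ne_zero fun h => by simp [h] at hdA
  have hdB2 : 2 ≤ dB := by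
    by_contra! h
    interval_cases dB <;> simp at hdB
  have : NeZero dA := ⟨hdA0.ne'⟩
  -- It suffices to use a resource that is small with respect to the first bound.
  have hmono : ∀ {N : ℕ}, 0 < N → N ≤ dA → N ≤ dB ^ 2 → N ≤ 4 * (dB / 2) + 2 →
      ImplementableByLOCC U (Real.logb 2 N) (2 * Real.logb 2 N) → ImplementableByLOCC U
      (Real.logb 2 ((min dA (min (dB ^ 2) (4 * (dB / 2) + 2)) : ℕ) : ℝ))
      (2 * Real.logb 2 ((min dA (min (dB ^ 2) (max 12 (4 * (dB / 2) + 2))) : ℕ) : ℝ)) :=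
    fun h0 h1 h2 h3 => ImplementableByLOCC.mono h0 (le_min h1 (le_min h2 h3))
      (le_min h1 (le_min h2 (h3.trans (le_max_right _ _))))
  have hsmall : ∀ {N : ℕ}, 0 < N → N ≤ dB ^ 2 → N ≤ 4 * (dB / 2) + 2 →
      ImplementableByLOCC U (Real.logb 2 N) (2 * Real.logb 2 N) → ImplementableByLOCC U
      (Real.logb 2 ((min dA (min (dB ^ 2) (4 * (dB / 2) + 2)) : ℕ) : ℝ))
      (2 * Real.logb 2 ((min dA (min (dB ^ 2) (max 12 (4 * (dB / 2) + 2))) : ℕ) : ℝ)) := by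
    intro N h0 h1 h2 h
    rcases le_total N dA with hN | hN
    · exact hmono h0 hN h1 h2 h
    · exact hmono hdA0 le_rfl (hN.trans h1) (hN.trans h2) (implementableByLOCC_controlled hUC hT)
  have hpaired : ∀ {T' : Fin dA → Matrix (Fin dB) (Fin dB) ℂ} {σ : Equiv.Perm (Fin dB)},
      LocallyEquivalent U (controlled T') → (∀ j, T' j ∈ unitaryGroup (Fin dB) ℂ) →
      (∀ i, σ (σ i) = i) → (∀ j i k, k ≠ i → k ≠ σ i → T' j k i = 0) → ImplementableByLOCC U
      (Real.logb 2 ((min dA (min (dB ^ 2) (4 * (dB / 2) + 2)) : ℕ) : ℝ))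
      (2 * Real.logb 2 ((min dA (min (dB ^ 2) (max 12 (4 * (dB / 2) + 2))) : ℕ) : ℝ)) :=
    fun h1 h2 h3 h4 => hsmall (N := 2 * dB) (by omega) (by nlinarith) (by omega)
      (implementableByLOCC_paired (by omega) h1 h2 h3 h4)
  obtain ⟨X, z₀, hz₀⟩ := exists_spanning_terms hrank hUC
  by_cases hA : ∀ j, ∃ z : Fin 3 → ℂ, (∃ i, z i = 0) ∧ T j = ∑ i, z i • T (X i)
  · choose z hz0 hz using hA
    choose κ hκ using hz0
    refine ⟨Or.inl ⟨3, _, _, le_rfl, isADirectSum_controlled hT κ, fun k =>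
      schmidtRankLE_controlled (fun i => T (X (k.succAbove i)))
        (fun j i => if κ j = k then z j (k.succAbove i) else 0) fun j => ?_⟩, ?_⟩
    · by_cases h : κ j = k
      · simp only [h, if_true]
        conv_lhs => rw [hz j, Fin.sum_univ_succAbove _ k]
        rw [← h, hκ, zero_smul, zero_add]
      · simp [h]
    · rcases hdB2.eq_or_lt with rfl | hdB3
      · -- For `dB = 2` all basis vectors form one pair, and the protocol needs only `4 = dB ^ 2`.
        refine hpaired (σ := Fin.revPerm) hUC hT (by simp) fun j i k h1 h2 => ?_
        exfalso
        revert i k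
        decide
      · obtain ⟨G, F, hG, hF, hFF, hcov⟩ :=
          exists_three_covering_blocks hT (fun i => hT (X i)) hz fun j => ⟨κ j, hκ j⟩
        choose b x y hx hy hTb using hcov
        exact hsmall (by norm_num) (by nlinarith) (by omega)
          (implementableByLOCC_three_blocks hUC hG hF hFF hx hy hTb)
  · push Not at hA
    obtain ⟨j₀, hj₀⟩ := hA
    obtain ⟨G, hG, Q, hQ, σ, hσ, hpair⟩ := exists_paired_terms hT hz₀ (j₀ := j₀)
      fun i hi => hj₀ (z₀ j₀) ⟨i, hi⟩ (hz₀ j₀)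
    have hUV := hUC.mul_right_controlled hG hQ
    have hTU : ∀ j, Gᴴ * T j * Q ∈ unitaryGroup (Fin dB) ℂ := fun j =>
      mul_mem (mul_mem (Unitary.star_mem hG) (hT j)) hQ
    refine ⟨Or.inr ?_, hpaired hUV hTU hσ hpair⟩
    obtain ⟨n, F, W, hsum, hW⟩ := exists_isBDirectSum_controlled hTU hσ hpair
      (fun i => Gᴴ * T (X i) * Q) z₀ fun j => by
        conv_lhs => rw [hz₀ j]
        simp only [Matrix.mul_sum, Matrix.sum_mul, Matrix.mul_smul, Matrix.smul_mul]
    exact ⟨_, n, F, W, hUV, hsum, hW⟩
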